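/- All graphs are finite and simple, and colors are integers. Let $a\ge b\ge 1$ and $c\ge 0$ be integers. An $a$-list assignment $L$ of a graph $G$ gives every vertex $v$ a set $L(v)$ of exactly $a$ colors; it is $c$-separating if $|L(u)\cap L(v)|\le c$ for every edge $uv$ of $G$. An $(L,b)$-coloring of $G$ is a map $\varphi$ that assigns to every vertex $v$ a set $\varphi(v)\subseteq L(v)$ with $|\varphi(v)|=b$ such that $\varphi(u)\cap\varphi(v)=\emptyset$ for every edge $uv$. The graph $G$ is $(a,b,c)$-free-choosable if for every $c$-separating $a$-list assignment $L$ of $G$, every vertex $v$ and every $C\subseteq L(v)$ with $|C|=b$, there is an $(L,b)$-coloring $\varphi$ of $G$ with $\varphi(v)=C$. The free-separation number of $G$ is $$\mathsf{fsep}(G,a,b)=\max\{c : 0\le c\le a,\ G \text{ is } (a,b,c)\text{-free-choosable}\};$$ the set is nonempty, since it contains $0$. A graph is outerplanar if it has a planar drawing in which all vertices lie on the boundary of the outer (unbounded) face. The girth of a graph is the length of a shortest cycle in it, and $C_n$ denotes the cycle with $n$ vertices. Theorem. Let $G$ be an outerplanar graph with finite girth $g\ge 5$, and let $a\ge b\ge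 1$ be integers. Then $$\mathsf{fsep}(C_{g-1},a,b)\le \mathsf{fsep}(G,a,b)\le \mathsf{fsep}(C_g,a,b).$$ -/

import Mathlib

namespace SimpleGraph

variable {V : Type*}

/-! List assignments, separation and free choosability. Colors are integers. -/

/-- An `a`-list assignment: every vertex receives a list of `a` colors. -/
def IsListAssignment (L : V → Finset ℤ) (a : ℕ) : Prop :=
  ∀ v, (L v).card = a

/-- `L` is `c`-separating: adjacent vertices share at most `c` colors of their lists. -/
def IsSeparating (G : SimpleGraph V) (c : ℕ) (L : V → Finset ℤ) : Prop :=
  ∀ u v, G.Adj u v → (L u ∩ L v).card ≤ c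

/-- `φ` is an `(L, b)`-coloring of `G`. -/
def IsListColoring (G : SimpleGraph V) (L : V → Finset ℤ) (b : ℕ) (φ : V → Finset ℤ) : Prop :=
  (∀ v, φ v ⊆ L v ∧ (φ v).card = b) ∧ ∀ u v, G.Adj u v → Disjoint (φ u) (φ v)

/-- `G` is `(a, b, c)`-free-choosable: for each `c`-separating `a`-list assignment `L`, each
vertex `v` and each set `C ⊆ L v` of `b` colors there is an `(L, b)`-coloring that gives `C`
to `v`. -/
def IsFreeChoosable (G : SimpleGraph V) (a b c : ℕ) : Prop :=
  ∀ L : V → Finset ℤ, IsListAssignment L a → G.IsSeparating c L →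
    ∀ (v : V) (C : Finset ℤ), C ⊆ L v → C.card = b →
      ∃ φ : V → Finset ℤ, G.IsListColoring L b φ ∧ φ v = C

/-- The free-separation number: the largest `c ≤ a` such that `G` is `(a, b, c)`-free-choosable.
(For `c ≥ a` the separation condition is void.) It is an honest maximum if `b ≤ a`, see
`isGreatest_fsep`. -/
noncomputable def fsep (G : SimpleGraph V) (a b : ℕ) : ℕ :=
  sSup {c : ℕ | c ≤ a ∧ G.IsFreeChoosable a b c}

theorem isFreeChoosable_zero (G : SimpleGraph V) {a b : ℕ} (hab : b ≤ a) :
    G.IsFreeChoosable a b 0 := by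
  classical
  intro L hL hs v C hC hCb
  have h : ∀ w, ∃ S : Finset ℤ, S ⊆ L w ∧ S.card = b := fun w =>
    Finset.exists_subset_card_eq (by rw [hL w]; exact hab)
  choose S hS hSb using h
  have hsub : ∀ w, Function.update S v C w ⊆ L w := by
    intro w
    by_cases hw : w = v
    · subst hw; simpa using hC
    · simpa [hw] using hS w
  refine ⟨Function.update S v C, ⟨fun w => ⟨hsub w, ?_⟩, fun u w huw => ?_⟩, by simp⟩
  · by_cases hw : w = v
    · subst hw; simpa using hCb
    · simpa [hw] using hSb w
  · have h0 : L u ∩ L w = ∅ := Finset.card_eq_zero.mp (Nat.le_zero.mp (hs u w huw))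
    exact (Finset.disjoint_iff_inter_eq_empty.mpr h0).mono (hsub u) (hsub w)

theorem isGreatest_fsep (G : SimpleGraph V) {a b : ℕ} (hab : b ≤ a) :
    IsGreatest {c : ℕ | c ≤ a ∧ G.IsFreeChoosable a b c} (G.fsep a b) := by
  have hb : BddAbove {c : ℕ | c ≤ a ∧ G.IsFreeChoosable a b c} := ⟨a, fun c hc => hc.1⟩
  exact ⟨Nat.sSup_mem ⟨0, Nat.zero_le a, G.isFreeChoosable_zero hab⟩ hb,
    fun c hc => le_csSup hb hc⟩

/-! Drawings in the plane, which is identified with `ℂ`, and outerplanarity. -/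

/-- A planar drawing of `G`: vertices are distinct points, each edge is a simple arc that joins
its two ends and passes through no other vertex, and two different edges meet at most in
vertices. -/
structure PlaneDrawing (G : SimpleGraph V) where
  /-- the point that represents a vertex -/
  point : V → ℂ
  /-- the arc that represents an edge -/
  arc : G.edgeSet → Set ℂ
  point_injective : Function.Injective point
  arc_isArc : ∀ (u v : V) (h : G.Adj u v), ∃ γ : _root_.Path (point u) (point v),
    Function.Injective γ ∧ Set.range γ = arc ⟨s(u, v), h⟩
  mem_of_point_mem_arc : ∀ (e : G.edgeSet) (w : V), point w ∈ arc e → w ∈ (e : Sym2 V)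
  arc_inter_arc : ∀ e f : G.edgeSet, e ≠ f → arc e ∩ arc f ⊆ Set.range point

/-- The set of points of the plane covered by a drawing. -/
def PlaneDrawing.carrier {G : SimpleGraph V} (D : G.PlaneDrawing) : Set ℂ :=
  Set.range D.point ∪ ⋃ e, D.arc e

/-- The outer (unbounded) face: the points off the drawing whose connected component in the
complement of the drawing is unbounded. (For a finite graph the drawing is compact and there is
exactly one unbounded component.) -/
def PlaneDrawing.outerFace {G : SimpleGraph V} (D : G.PlaneDrawing) : Set ℂ :=
  {z | z ∈ D.carrierᶜ ∧ ¬ Bornology.IsBounded (connectedComponentIn D.carrierᶜ z)}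

/-- `G` is outerplanar: it has a planar drawing in which all vertices lie on the boundary of the
outer face. -/
def IsOuterplanar (G : SimpleGraph V) : Prop :=
  ∃ D : G.PlaneDrawing, ∀ v, D.point v ∈ frontier D.outerFace

end SimpleGraph

/-!
The second inequality holds for every finite graph. A shortest cycle of `G` has no chord, so a
separating list assignment of the cycle extends to one of `G` by giving each other vertex a list of
new colors, and a coloring of `G` restricts to the cycle.

For the first inequality let `k = g - 2`. The proof has a topological, a graph-theoretic and a
coloring part.

*Topology.* An outerplanar graph contains no subdivision of `K₂,₃`, that is, no theta subgraph whose
three paths all have inner vertices (`SimpleGraph.IsOuterplanar.thetaFree`). For a theta curve in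
the plane whose arcs all touch the outer face this is `theta_curve_not_outer`. The necessary facts
about separation of the plane are proved with continuous logarithms, following Eilenberg: a compact
set `K` separates `p` from infinity if and only if `z - p` has no continuous logarithm on `K`
(`hasLogOn_sub_of_unbounded`, `not_frontier_subset_of_hasLogOn`). Logarithms exist on arcs and can be
glued along connected intersections (`HasLogOn.union`), so arcs do not separate the plane and
Janiszewski's theorem holds. A closed curve does separate the plane
(`exists_isBounded_connectedComponentIn`).

*Graphs.* In a theta-free graph of girth at least `g`, a nonempty set `T` of vertices whose outside
neighbours form a clique contains a vertex of degree at most one or `k` consecutive inner vertices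
of a path that have degree two (`SimpleGraph.ThetaFree.exists_leaf_or_ear`). Indeed a minimal such
set has two adjacent outside neighbours `u` and `v`, and a shortest path from `u` to `v` through `T`
must cover `T`. Applied to the vertices other than the precolored one, this reduces the theorem to
extending a coloring of the two ends of a path to its `k` inner vertices.

*Colorings.* If the cycle with `k + 1` vertices is free-choosable, then such an extension always
exists, although the ends of the path may have different color sets
(`SimpleGraph.IsFreeChoosable.pathExtendable`). On the one hand, list assignments of the cycle in
which every color lies in at most two consecutive lists give inequalities between `a`, `b`, `c` and
`k` (`SimpleGraph.IsFreeChoosable.sum_le`). On the other hand, these inequalities are what two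
coloring procedures for paths need: a greedy one, which saves colors for the next vertex
(`exists_isPathColoring_greedy`), and one for `a ≥ 2 b`, in which the color sets at every other
vertex approach the prescribed set at the end by `a - 2 b` elements per step
(`exists_isPathColoring_near_target`).
-/

section PlaneSeparation

open Set Metric Bornology

/-! ### Continuous logarithms -/

/-- `f` has a continuous logarithm on `K`. -/
def HasLogOn {X : Type*} [TopologicalSpace X] (f : X → ℂ) (K : Set X) : Prop :=
  ∃ g : X → ℂ, ContinuousOn g K ∧ ∀ z ∈ K, Complex.exp (g z) = f z

namespace HasLogOn

variable {X : Type*} [TopologicalSpace X] {f f₁ f₂ : X → ℂ} {A B K : Set X}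

theorem mono (h : HasLogOn f B) (hAB : A ⊆ B) : HasLogOn f A :=
  let ⟨g, hg, hgf⟩ := h
  ⟨g, hg.mono hAB, fun z hz => hgf z (hAB hz)⟩

theorem congr (h : HasLogOn f₁ K) (hf : EqOn f₁ f₂ K) : HasLogOn f₂ K :=
  let ⟨g, hg, hgf⟩ := h
  ⟨g, hg, fun z hz => (hgf z hz).trans (hf hz)⟩

theorem mul (h₁ : HasLogOn f₁ K) (h₂ : HasLogOn f₂ K) :
    HasLogOn (fun z => f₁ z * f₂ z) K := by
  obtain ⟨g₁, hg₁, e₁⟩ := h₁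
  obtain ⟨g₂, hg₂, e₂⟩ := h₂
  exact ⟨fun z => g₁ z + g₂ z, hg₁.add hg₂, fun z hz => by rw [Complex.exp_add, e₁ z hz, e₂ z hz]⟩

theorem of_slitPlane (hf : ContinuousOn f K) (h : ∀ z ∈ K, f z ∈ Complex.slitPlane) :
    HasLogOn f K :=
  ⟨fun z => Complex.log (f z), hf.clog h,
    fun z hz => Complex.exp_log (Complex.slitPlane_ne_zero (h z hz))⟩

theorem const {c : ℂ} (hc : c ≠ 0) : HasLogOn (fun _ => c) K :=
  ⟨fun _ => Complex.log c, continuousOn_const, fun _ _ => Complex.exp_log hc⟩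

end HasLogOn

/-- Two logarithms of the same function on a connected set differ by a constant, because
`2πiℤ` is discrete. -/
theorem exists_eqOn_add_of_exp_eq {X : Type*} [TopologicalSpace X] {S : Set X}
    (hS : IsPreconnected S) {g₁ g₂ : X → ℂ} (h₁ : ContinuousOn g₁ S) (h₂ : ContinuousOn g₂ S)
    (h : ∀ z ∈ S, Complex.exp (g₁ z) = Complex.exp (g₂ z)) :
    ∃ c : ℂ, Complex.exp c = 1 ∧ ∀ z ∈ S, g₁ z = g₂ z + c := by
  have hT : IsDiscrete ((AddSubgroup.zmultiples (2 * Real.pi * Complex.I) : AddSubgroup ℂ) :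
      Set ℂ) := ⟨NormedSpace.discreteTopology_zmultiples _⟩
  obtain ⟨c, hc, hE⟩ := hS.eqOn_const_of_mapsTo hT (h₁.sub h₂) (fun z hz => by
    obtain ⟨n, hn⟩ := Complex.exp_eq_exp_iff_exists_int.1 (h z hz)
    refine AddSubgroup.mem_zmultiples_iff.2 ⟨n, ?_⟩
    simp [hn]) ⟨0, AddSubgroup.zero_mem _⟩
  refine ⟨c, ?_, fun z hz => ?_⟩
  · obtain ⟨n, rfl⟩ := AddSubgroup.mem_zmultiples_iff.1 hc
    rw [zsmul_eq_mul]; exact Complex.exp_int_mul_two_pi_mul_I n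
  · have := hE hz
    simp only [Function.const_apply, Pi.sub_apply] at this
    rw [← this]; ring

/-- Gluing: two logarithms on sets with connected intersection differ by a constant there, so
one of them can be shifted to match the other. -/
theorem HasLogOn.union {X : Type*} [TopologicalSpace X] {f : X → ℂ} {A B : Set X}
    (hAB : (IsClosed A ∧ IsClosed B) ∨ (IsOpen A ∧ IsOpen B)) (hc : IsPreconnected (A ∩ B))
    (hA : HasLogOn f A) (hB : HasLogOn f B) : HasLogOn f (A ∪ B) := by
  classical
  obtain ⟨g₁, hg₁, e₁⟩ := hA
  obtain ⟨g₂, hg₂, e₂⟩ := hB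
  obtain ⟨c, hc1, hc2⟩ := exists_eqOn_add_of_exp_eq hc (hg₁.mono inter_subset_left)
    (hg₂.mono inter_subset_right) (fun z hz => (e₁ z hz.1).trans (e₂ z hz.2).symm)
  let g : X → ℂ := fun z => if z ∈ A then g₁ z else g₂ z + c
  have gA : EqOn g g₁ A := fun z hz => if_pos hz
  have gB : EqOn g (fun z => g₂ z + c) B := fun z hz => by
    by_cases h : z ∈ A
    · exact (if_pos h).trans (hc2 z ⟨h, hz⟩)
    · exact if_neg h
  have cA : ContinuousOn g A := hg₁.congr gA
  have cB : ContinuousOn g B := (hg₂.add continuousOn_const).congr gB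
  refine ⟨g, ?_, ?_⟩
  · rcases hAB with h | h
    · exact cA.union_of_isClosed cB h.1 h.2
    · exact cA.union_of_isOpen cB h.1 h.2
  · rintro z (hz | hz)
    · rw [gA hz, e₁ z hz]
    · rw [gB hz, Complex.exp_add, hc1, mul_one, e₂ z hz]

/-- A homotopy in `ℂ \ {0}` that starts at a constant map provides its end map with a
logarithm, because `exp` is a covering map. -/
theorem HasLogOn.of_homotopy {X : Type*} [TopologicalSpace X] {K : Set X} {c : ℂ}
    (H : unitInterval × K → ℂ) (hH : Continuous H) (h0 : ∀ x, H x ≠ 0)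
    (hc : ∀ x, H (0, x) = c) {f : X → ℂ} (hf : ∀ x : K, H (1, x) = f x) : HasLogOn f K := by
  classical
  rcases K.eq_empty_or_nonempty with rfl | ⟨x₀, hx₀⟩
  · exact ⟨fun _ => 0, continuousOn_const, fun z hz => absurd hz (notMem_empty z)⟩
  have hc0 : c ≠ 0 := hc ⟨x₀, hx₀⟩ ▸ h0 _
  let H' : C(unitInterval × K, {z : ℂ // z ≠ 0}) := ⟨fun x => ⟨H x, h0 x⟩, by fun_prop⟩
  have H0 : ∀ a, H' (0, a) = ⟨_, Complex.exp_ne_zero (Complex.log c)⟩ := fun a =>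
    Subtype.ext (by simp [H', hc, Complex.exp_log hc0])
  let G := Complex.isCoveringMap_exp.liftHomotopy H' (ContinuousMap.const K (Complex.log c)) H0
  have hG := Complex.isCoveringMap_exp.liftHomotopy_lifts H'
    (ContinuousMap.const K (Complex.log c)) H0
  refine ⟨fun z => if hz : z ∈ K then G (1, ⟨z, hz⟩) else 0, ?_, fun z hz => ?_⟩
  · rw [continuousOn_iff_continuous_domRestrict]
    have : Continuous fun z : K => G (1, z) := by fun_prop
    convert this using 2 with z
    simp
  · have := congrArg Subtype.val (congrFun hG (1, ⟨z, hz⟩))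
    simp only [dif_pos hz, ← hf ⟨z, hz⟩]
    exact this

/-- Contract a star-convex set to its centre. -/
theorem HasLogOn.of_starConvex {E : Type*} [NormedAddCommGroup E] [NormedSpace ℝ E] {K : Set E}
    {c : E} (hK : StarConvex ℝ c K) {f : E → ℂ} (hf : ContinuousOn f K)
    (h0 : ∀ z ∈ K, f z ≠ 0) : HasLogOn f K := by
  have key : ∀ x : unitInterval × K, c + (x.1 : ℝ) • ((x.2 : E) - c) ∈ K := fun x =>
    hK.add_smul_sub_mem x.2.2 x.1.2.1 x.1.2.2
  refine HasLogOn.of_homotopy (c := f c)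
    (fun x => f (c + (x.1 : ℝ) • ((x.2 : E) - c))) ?_ (fun x => h0 _ (key x)) (by simp) (by simp)
  exact hf.comp_continuous (by fun_prop) key

/-- On a circle around `p` the function `z - p` has no logarithm, as its argument grows by `2π`
along the circle. -/
theorem not_hasLogOn_sphere {p : ℂ} {R : ℝ} (hR : 0 < R) :
    ¬ HasLogOn (fun z => z - p) (sphere p R) := by
  rintro ⟨g, hg, e⟩
  have hmem : ∀ t : ℝ, circleMap p R t ∈ sphere p R := fun t =>
    circleMap_mem_sphere p hR.le t
  obtain ⟨c, -, hc⟩ := exists_eqOn_add_of_exp_eq (S := (univ : Set ℝ)) isPreconnected_univ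
    (g₁ := fun t => g (circleMap p R t)) (g₂ := fun t => Real.log R + t * Complex.I)
    (hg.comp (by fun_prop) (fun t _ => hmem t)) (by fun_prop) (fun t _ => by
      rw [e _ (hmem t), Complex.exp_add, ← Complex.ofReal_exp, Real.exp_log hR]
      simp [circleMap])
  have h0 := hc 0 trivial
  have h1 := hc (2 * Real.pi) trivial
  have : circleMap p R (2 * Real.pi) = circleMap p R 0 := by
    simp [circleMap]
  simp only [this, h0] at h1
  have := congrArg Complex.im h1
  simp at this

/-! ### Separation of the plane by compact sets -/

/-- A translate `z - p` has a logarithm on a compact set `K` if `p` can be moved to infinity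
off `K`. -/
theorem hasLogOn_sub_of_unbounded {K S : Set ℂ} (hK : IsCompact K) (hS : IsPreconnected S)
    (hSK : S ⊆ Kᶜ) (hSb : ¬ IsBounded S) {p : ℂ} (hp : p ∈ S) :
    HasLogOn (fun z => z - p) K := by
  -- for nearby points off `K` the two translates differ by a factor close to one
  have key : ∀ p ∈ Kᶜ, ∃ ε > 0, ball p ε ⊆ Kᶜ ∧ ∀ q ∈ ball p ε,
      (HasLogOn (fun z => z - p) K ↔ HasLogOn (fun z => z - q) K) := by
    intro p hp
    obtain ⟨ε, hε, hball⟩ := Metric.isOpen_iff.1 hK.isClosed.isOpen_compl p hp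
    refine ⟨ε, hε, hball, fun q hq => ?_⟩
    have hne : ∀ z ∈ K, z - p ≠ 0 := fun z hz h => hp (sub_eq_zero.1 h ▸ hz)
    have hneq : ∀ z ∈ K, z - q ≠ 0 := fun z hz h => hball hq (sub_eq_zero.1 h ▸ hz)
    have hslit : ∀ z ∈ K, (z - q) / (z - p) ∈ Complex.slitPlane := by
      intro z hz
      have hzε : ε ≤ ‖z - p‖ := by
        by_contra h
        exact hball (mem_ball_iff_norm.2 (not_le.1 h)) hz
      have : (z - q) / (z - p) = 1 + (p - q) / (z - p) := by
        field_simp [hne z hz]; ring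
      rw [this]
      refine Complex.mem_slitPlane_of_norm_lt_one ?_
      rw [norm_div, div_lt_one (hε.trans_le hzε)]
      rw [mem_ball_iff_norm, norm_sub_rev] at hq
      exact hq.trans_le hzε
    have hcont : ContinuousOn (fun z => (z - q) / (z - p)) K :=
      (by fun_prop : ContinuousOn (fun z : ℂ => z - q) K).div (by fun_prop) hne
    constructor
    · intro h
      refine (h.mul (HasLogOn.of_slitPlane hcont hslit)).congr fun z hz => ?_
      have := hne z hz
      field_simp
    · intro h
      refine (h.mul (HasLogOn.of_slitPlane (f := fun z => ((z - q) / (z - p))⁻¹)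
        (hcont.inv₀ fun z hz => div_ne_zero (hneq z hz) (hne z hz))
        fun z hz => ?_)).congr fun z hz => ?_
      · have := hslit z hz
        rw [Complex.mem_slitPlane_iff_arg] at this ⊢
        refine ⟨?_, inv_ne_zero this.2⟩
        rw [Complex.arg_inv, if_neg this.1]
        have h1 := Complex.neg_pi_lt_arg ((z - q) / (z - p))
        intro h2; linarith
      · have := hne z hz
        have := hneq z hz
        simp only
        field_simp
  obtain ⟨R, hR⟩ := hK.isBounded.subset_ball 0
  obtain ⟨q, hqS, hqR⟩ : ∃ q ∈ S, max R 0 < ‖q‖ := by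
    by_contra! h
    exact hSb ((isBounded_iff_forall_norm_le).2 ⟨_, h⟩)
  have hq0 : q ≠ 0 := fun h => by simp [h] at hqR
  have hfar : HasLogOn (fun z => z - q) K := by
    refine ((HasLogOn.const (neg_ne_zero.2 hq0)).mul
      (HasLogOn.of_slitPlane (f := fun z => 1 + (-z / q)) (by fun_prop) fun z hz =>
        Complex.mem_slitPlane_of_norm_lt_one ?_)).congr fun z _ => ?_
    · have hz := hR hz
      rw [mem_ball_zero_iff] at hz
      rw [norm_div, norm_neg, div_lt_one (norm_pos_iff.2 hq0)]
      exact hz.trans ((le_max_left _ _).trans_lt hqR)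
    · simp only; field_simp; ring
  by_contra hp'
  have hopen : ∀ P : Prop, IsOpen {p | p ∈ Kᶜ ∧ (HasLogOn (fun z => z - p) K ↔ P)} := by
    intro P
    refine Metric.isOpen_iff.2 fun x hx => ?_
    obtain ⟨ε, hε, h1, h2⟩ := key x hx.1
    exact ⟨ε, hε, fun y hy => ⟨h1 hy, (h2 y hy).symm.trans hx.2⟩⟩
  obtain ⟨x, -, hx1, hx2⟩ := hS _ _ (hopen True) (hopen False) (fun x hx => by
    by_cases h : HasLogOn (fun z => z - x) K
    · exact Or.inl ⟨hSK hx, by simp [h]⟩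
    · exact Or.inr ⟨hSK hx, by simp [h]⟩) ⟨q, hqS, hSK hqS, by simp [hfar]⟩
    ⟨p, hp, hSK hp, by simp [hp']⟩
  exact (hx2.2.1 (hx1.2.2 trivial))

/-- If `z - p` has a logarithm on the compact set `K`, then `K` does not contain the boundary of
a bounded neighbourhood `W` of `p`: otherwise extend the logarithm over `W`; the function that is
`z - p` off `W` and the exponential of the extension on `W` vanishes nowhere, hence has a
logarithm on a large disc, and so has `z - p` on the bounding circle. -/
theorem not_frontier_subset_of_hasLogOn {K W : Set ℂ} (hK : IsCompact K) {p : ℂ}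
    (h : HasLogOn (fun z => z - p) K) (hW : IsBounded W) (hpW : W ∈ nhds p) :
    ¬ frontier W ⊆ K := by
  classical
  intro hfr
  obtain ⟨g, hg, e⟩ := h
  obtain ⟨G, hG⟩ := ContinuousMap.exists_restrict_eq hK.isClosed
    (⟨K.domRestrict g, continuousOn_iff_continuous_domRestrict.1 hg⟩ : C(K, ℂ))
  have hGK : ∀ z ∈ K, Complex.exp (G z) = z - p := fun z hz => by
    have := DFunLike.congr_fun hG ⟨z, hz⟩
    simp only [ContinuousMap.restrict_apply, ContinuousMap.coe_mk, domRestrict_apply] at this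
    rw [this, e z hz]
  let F : ℂ → ℂ := fun z => if z ∈ closure W then Complex.exp (G z) else z - p
  have hF : Continuous F := by
    refine Continuous.if (fun z hz => hGK z (hfr (frontier_closure_subset hz))) ?_ ?_
    · fun_prop
    · fun_prop
  have hF0 : ∀ z, F z ≠ 0 := by
    intro z
    by_cases hz : z ∈ closure W
    · simp only [F, if_pos hz]; exact Complex.exp_ne_zero _
    · simp only [F, if_neg hz]
      intro h
      exact hz (subset_closure (mem_of_mem_nhds (by rwa [sub_eq_zero.1 h])))
  obtain ⟨R, hR0, hR⟩ := hW.closure.subset_ball_lt 0 p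
  have := (HasLogOn.of_starConvex
    ((convex_closedBall p R).starConvex (mem_closedBall_self hR0.le)) hF.continuousOn
    (fun z _ => hF0 z)).mono (sphere_subset_closedBall (x := p) (ε := R))
  refine not_hasLogOn_sphere hR0 (this.congr fun z hz => if_neg fun hz' => ?_)
  exact (ne_of_lt (mem_ball.1 (hR hz'))) (mem_sphere.1 hz)

/-- If `u` can be moved to `v` inside the set `A`, then `(z - u) / (z - v)` has a logarithm
off `A`. -/
theorem hasLogOn_div_of_joinedIn {A : Set ℂ} {u v : ℂ} (h : JoinedIn A u v) :
    HasLogOn (fun z => (z - u) / (z - v)) Aᶜ := by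
  obtain ⟨γ, hγ⟩ := h.symm
  have hne : ∀ (t : unitInterval) (z : (Aᶜ : Set ℂ)), (z : ℂ) - γ t ≠ 0 := fun t z h =>
    z.2 (sub_eq_zero.1 h ▸ hγ t)
  have hv : ∀ z : (Aᶜ : Set ℂ), (z : ℂ) - v ≠ 0 := fun z => by simpa using hne 0 z
  refine HasLogOn.of_homotopy (c := 1)
    (fun x : unitInterval × (Aᶜ : Set ℂ) => ((x.2 : ℂ) - γ x.1) / ((x.2 : ℂ) - v)) ?_
    (fun x => div_ne_zero (hne x.1 x.2) (hv x.2)) (fun x => ?_) (fun x => ?_)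
  · exact Continuous.div (by fun_prop) (by fun_prop) fun x => hv x.2
  · simp [div_self (hv x)]
  · simp

/-- The separation part of the Jordan curve theorem. If the complement of `A ∪ B` were connected,
the logarithms of `(z - u) / (z - v)` off `A` and off `B` could be glued to one on all of
`ℂ \ {u, v}`, but there is none on a small circle around `u`. -/
theorem not_isPreconnected_compl_union {A B : Set ℂ} (hA : IsClosed A) (hB : IsClosed B)
    {u v : ℂ} (huv : u ≠ v) (hAj : JoinedIn A u v) (hBj : JoinedIn B u v)
    (hAB : A ∩ B = {u, v}) : ¬ IsPreconnected (A ∪ B)ᶜ := by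
  intro h
  rw [compl_union] at h
  have hlog := HasLogOn.union (Or.inr ⟨hA.isOpen_compl, hB.isOpen_compl⟩) h
    (hasLogOn_div_of_joinedIn hAj) (hasLogOn_div_of_joinedIn hBj)
  rw [← compl_inter, hAB] at hlog
  have hd : 0 < dist u v := dist_pos.2 huv
  have hvball : v ∉ closedBall u (dist u v / 2) := by
    rw [mem_closedBall, dist_comm]; linarith
  have h2 : HasLogOn (fun z => z - v) (closedBall u (dist u v / 2)) :=
    HasLogOn.of_starConvex ((convex_closedBall _ _).starConvex (mem_closedBall_self (by positivity)))
      (by fun_prop) (fun z hz h => hvball (sub_eq_zero.1 h ▸ hz))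
  have hsub : sphere u (dist u v / 2) ⊆ ({u, v} : Set ℂ)ᶜ := by
    intro z hz hz'
    rcases hz' with rfl | rfl
    · simp only [mem_sphere] at hz; rw [dist_self] at hz; linarith
    · exact hvball (sphere_subset_closedBall hz)
  refine not_hasLogOn_sphere (half_pos hd)
    (((hlog.mono hsub).mul (h2.mono sphere_subset_closedBall)).congr fun z hz => ?_)
  have : z - v ≠ 0 := fun h => hsub hz (by simp [sub_eq_zero.1 h])
  simp only
  field_simp

/-- The outside of a disc is the image of a half-plane under `exp`. -/
theorem isPreconnected_lt_norm {R : ℝ} (hR : 0 < R) : IsPreconnected {z : ℂ | R < ‖z‖} := by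
  have : {z : ℂ | R < ‖z‖} = Complex.exp '' {w | Real.log R < w.re} := by
    ext z
    constructor
    · intro hz
      have hz0 : z ≠ 0 := norm_pos_iff.1 (hR.trans hz)
      exact ⟨Complex.log z, by simpa [Complex.log_re] using Real.log_lt_log hR hz,
        Complex.exp_log hz0⟩
    · rintro ⟨w, hw, rfl⟩
      simpa [Complex.norm_exp] using (Real.log_lt_iff_lt_exp hR).1 hw
  rw [this]
  exact (convex_halfSpace_re_gt _).isPreconnected.image _ Complex.continuous_exp.continuousOn

/-- The complement of a Jordan curve has a bounded component. -/
theorem exists_isBounded_connectedComponentIn {A B : Set ℂ} (hA : IsCompact A) (hB : IsCompact B)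
    {u v : ℂ} (huv : u ≠ v) (hAj : JoinedIn A u v) (hBj : JoinedIn B u v)
    (hAB : A ∩ B = {u, v}) :
    ∃ p ∈ (A ∪ B)ᶜ, IsBounded (connectedComponentIn (A ∪ B)ᶜ p) := by
  by_contra! h
  refine not_isPreconnected_compl_union hA.isClosed hB.isClosed huv hAj hBj hAB ?_
  obtain ⟨R, hR0, hR⟩ := (hA.union hB).isBounded.subset_ball_lt 0 0
  have hfar : {z : ℂ | R < ‖z‖} ⊆ (A ∪ B)ᶜ := fun z hz hz' => by
    have := mem_ball_zero_iff.1 (hR hz')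
    exact lt_asymm this hz
  obtain ⟨q, hq⟩ : ∃ q : ℂ, R < ‖q‖ := ⟨((R + 1 : ℝ) : ℂ), by
    rw [Complex.norm_real, Real.norm_of_nonneg (by linarith)]; linarith⟩
  refine isPreconnected_of_forall q fun p hp => ?_
  obtain ⟨x, hx, hxR⟩ : ∃ x ∈ connectedComponentIn (A ∪ B)ᶜ p, R < ‖x‖ := by
    by_contra! h'
    exact h p hp ((isBounded_iff_forall_norm_le).2 ⟨_, h'⟩)
  exact ⟨_, union_subset hfar (connectedComponentIn_subset _ p), Or.inl hq,
    Or.inr (mem_connectedComponentIn hp),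
    (isPreconnected_lt_norm hR0).union x hxR hx isPreconnected_connectedComponentIn⟩

theorem frontier_connectedComponentIn_compl_subset {K : Set ℂ} (hK : IsClosed K) (p : ℂ) :
    frontier (connectedComponentIn Kᶜ p) ⊆ K := by
  intro x hx
  by_contra hxK
  have hopen := hK.isOpen_compl.connectedComponentIn (x := x)
  have hxm : x ∈ connectedComponentIn Kᶜ x := mem_connectedComponentIn hxK
  obtain ⟨y, hy1, hy2⟩ := mem_closure_iff.1 hx.1 _ hopen hxm
  have := connectedComponentIn_eq hy1
  have := connectedComponentIn_eq hy2
  refine hx.2 (mem_interior.2 ⟨_, subset_rfl, hK.isOpen_compl.connectedComponentIn, ?_⟩)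
  simp_all

/-! ### Arcs and theta curves -/

/-- The properties of an arc `P` from `u` to `v` that are used to study theta curves. They are
inherited by a concatenation of arcs, so no parametrization of `P` is needed. -/
structure IsArcLike (P : Set ℂ) (u v : ℂ) : Prop where
  ne : u ≠ v
  isCompact : IsCompact P
  joinedIn : JoinedIn P u v
  isPreconnected : IsPreconnected P
  isPreconnected_left : IsPreconnected (P \ {u})
  isPreconnected_right : IsPreconnected (P \ {v})
  isPreconnected_interior : IsPreconnected (P \ {u, v})
  hasLogOn : ∀ p ∉ P, HasLogOn (fun z => z - p) P

theorem IsArcLike.of_path {u v : ℂ} (γ : Path u v) (hγ : Function.Injective γ) :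
    IsArcLike (range γ) u v := by
  have hemb : Topology.IsClosedEmbedding γ := γ.continuous.isClosedEmbedding hγ
  have himg : ∀ S : Set unitInterval, IsPreconnected S → IsPreconnected (γ '' S) := fun S hS =>
    hS.image _ γ.continuous.continuousOn
  have hdiff : ∀ S : Set unitInterval, range γ \ γ '' S = γ '' Sᶜ := fun S => by
    rw [image_compl_eq_range_sdiff_image hγ]
  refine ⟨?_, isCompact_range γ.continuous, ⟨γ, mem_range_self⟩,
    isPreconnected_range γ.continuous, ?_, ?_, ?_, ?_⟩
  · exact fun h => zero_ne_one (hγ (γ.source.trans (h.trans γ.target.symm)))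
  · have : range γ \ {u} = γ '' Ioi 0 := by
      rw [show ({u} : Set ℂ) = γ '' {0} by simp, hdiff]
      congr 1; ext t; simp [unitInterval.pos_iff_ne_zero]
    rw [this]; exact himg _ isPreconnected_Ioi
  · have : range γ \ {v} = γ '' Iio 1 := by
      rw [show ({v} : Set ℂ) = γ '' {1} by simp, hdiff]
      congr 1; ext t; simp [unitInterval.lt_one_iff_ne_one]
    rw [this]; exact himg _ isPreconnected_Iio
  · have : range γ \ {u, v} = γ '' Ioo 0 1 := by
      rw [show ({u, v} : Set ℂ) = γ '' {0, 1} by simp [image_pair], hdiff]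
      congr 1; ext t; simp [unitInterval.lt_one_iff_ne_one, unitInterval.pos_iff_ne_zero]
    rw [this]; exact himg _ isPreconnected_Ioo
  · intro p hp
    let e := hemb.toIsEmbedding.toHomeomorph
    have he : ∀ z, γ (e.symm z) = z := fun z => congrArg Subtype.val (e.apply_symm_apply z)
    refine HasLogOn.of_homotopy (c := u - p) (fun x => γ (x.1 * e.symm x.2) - p) ?_ ?_ ?_ ?_
    · fun_prop
    · intro x h
      exact hp ⟨_, sub_eq_zero.1 h⟩
    · intro x; simp
    · intro x; simp [he]

theorem IsArcLike.trans {P Q : Set ℂ} {u w v : ℂ} (hP : IsArcLike P u w) (hQ : IsArcLike Q w v)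
    (hPQ : P ∩ Q = {w}) : IsArcLike (P ∪ Q) u v := by
  have huP : u ∈ P := hP.joinedIn.source_mem
  have hwP : w ∈ P := hP.joinedIn.target_mem
  have hwQ : w ∈ Q := hQ.joinedIn.source_mem
  have hvQ : v ∈ Q := hQ.joinedIn.target_mem
  have huQ : u ∉ Q := fun h => hP.ne (mem_singleton_iff.1 (hPQ ▸ ⟨huP, h⟩))
  have hvP : v ∉ P := fun h => hQ.ne (mem_singleton_iff.1 (hPQ ▸ ⟨h, hvQ⟩)).symm
  refine ⟨fun h => huQ (h ▸ hvQ), hP.isCompact.union hQ.isCompact,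
    (hP.joinedIn.mono subset_union_left).trans (hQ.joinedIn.mono subset_union_right),
    hP.isPreconnected.union w hwP hwQ hQ.isPreconnected, ?_, ?_, ?_, ?_⟩
  · rw [union_sdiff_distrib, sdiff_singleton_eq_self huQ]
    exact hP.isPreconnected_left.union w ⟨hwP, hP.ne.symm⟩ hwQ hQ.isPreconnected
  · rw [union_sdiff_distrib, sdiff_singleton_eq_self hvP]
    exact hP.isPreconnected.union w hwP ⟨hwQ, hQ.ne⟩ hQ.isPreconnected_right
  · have : (P ∪ Q) \ {u, v} = P \ {u} ∪ Q \ {v} := by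
      ext z
      simp only [mem_sdiff, mem_union, mem_insert_iff, mem_singleton_iff, not_or]
      constructor
      · rintro ⟨h | h, h1, h2⟩
        · exact Or.inl ⟨h, h1⟩
        · exact Or.inr ⟨h, h2⟩
      · rintro (⟨h, h1⟩ | ⟨h, h1⟩)
        · exact ⟨Or.inl h, h1, fun h2 => hvP (h2 ▸ h)⟩
        · exact ⟨Or.inr h, fun h2 => huQ (h2 ▸ h), h1⟩
    rw [this]
    exact hP.isPreconnected_left.union w ⟨hwP, hP.ne.symm⟩ ⟨hwQ, hQ.ne⟩ hQ.isPreconnected_right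
  · intro p hp
    rw [mem_union, not_or] at hp
    refine HasLogOn.union (Or.inl ⟨hP.isCompact.isClosed, hQ.isCompact.isClosed⟩) ?_
      (hP.hasLogOn p hp.1) (hQ.hasLogOn p hp.2)
    rw [hPQ]; exact isPreconnected_singleton

/-- If one point of the connected set `S` is a limit of points that can be moved to infinity
off the closed set `J`, then all points of `S` can be. -/
theorem not_isBounded_connectedComponentIn_of_mem_closure {J S O : Set ℂ} (hJ : IsClosed J)
    (hS : IsPreconnected S) (hSJ : S ⊆ Jᶜ) {w : ℂ} (hwS : w ∈ S) (hwO : w ∈ closure O)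
    (hO : ∀ z ∈ O, ¬ IsBounded (connectedComponentIn Jᶜ z)) :
    ∀ x ∈ S, ¬ IsBounded (connectedComponentIn Jᶜ x) := by
  intro x hx
  obtain ⟨y, hyw, hyO⟩ := mem_closure_iff.1 hwO _ (hJ.isOpen_compl.connectedComponentIn (x := w))
    (mem_connectedComponentIn (hSJ hwS))
  have h1 := connectedComponentIn_eq (hS.subset_connectedComponentIn hwS hSJ hx)
  rw [← h1, connectedComponentIn_eq hyw]
  exact hO y hyO

/-- A bounded set that is a component of the complement of both `J` and `K` has its boundary in
`J ∩ K`. -/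
theorem frontier_subset_inter_of_disjoint {J K : Set ℂ} (hJ : IsClosed J) (hK : IsClosed K)
    {p : ℂ} (hpJ : p ∈ Jᶜ) (hpK : p ∈ Kᶜ) (h₁ : connectedComponentIn Jᶜ p ⊆ Kᶜ)
    (h₂ : connectedComponentIn Kᶜ p ⊆ Jᶜ) : frontier (connectedComponentIn Jᶜ p) ⊆ J ∩ K := by
  have : connectedComponentIn Jᶜ p = connectedComponentIn Kᶜ p :=
    (isPreconnected_connectedComponentIn.subset_connectedComponentIn
      (mem_connectedComponentIn hpJ) h₁).antisymm
    (isPreconnected_connectedComponentIn.subset_connectedComponentIn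
      (mem_connectedComponentIn hpK) h₂)
  exact subset_inter (frontier_connectedComponentIn_compl_subset hJ p)
    (this ▸ frontier_connectedComponentIn_compl_subset hK p)

/-- The outer face of a theta curve is not adjacent to all three arcs: otherwise each arc lies,
apart from its ends, in the unbounded component of the complement of the closed curve formed by the
two others. A bounded component `W` of the complement of `P₁ ∪ P₂` then avoids `P₃`. If `W` were
also a component of the complement of `P₁ ∪ P₃` (or `P₂ ∪ P₃`), its boundary would lie in an arc.
So a point `p` of `W` is separated from infinity neither by `P₁ ∪ P₃` nor by `P₂ ∪ P₃`, and as
these meet in the connected set `P₃`, the two logarithms of `z - p` can be glued; but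
`P₁ ∪ P₂ ∪ P₃` does separate `p` from infinity. -/
theorem theta_curve_not_outer {P₁ P₂ P₃ O : Set ℂ} {u v w₁ w₂ w₃ : ℂ} (h₁ : IsArcLike P₁ u v)
    (h₂ : IsArcLike P₂ u v) (h₃ : IsArcLike P₃ u v) (h₁₂ : P₁ ∩ P₂ = {u, v})
    (h₁₃ : P₁ ∩ P₃ = {u, v}) (h₂₃ : P₂ ∩ P₃ = {u, v})
    (hO : ∀ z ∈ O, ¬ IsBounded (connectedComponentIn (P₁ ∪ P₂ ∪ P₃)ᶜ z))
    (hw₁ : w₁ ∈ P₁ \ {u, v}) (hw₂ : w₂ ∈ P₂ \ {u, v}) (hw₃ : w₃ ∈ P₃ \ {u, v})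
    (hO₁ : w₁ ∈ closure O) (hO₂ : w₂ ∈ closure O) (hO₃ : w₃ ∈ closure O) : False := by
  have c₁ := h₁.isCompact.isClosed
  have c₂ := h₂.isCompact.isClosed
  have c₃ := h₃.isCompact.isClosed
  have outer : ∀ {P Q R : Set ℂ} {w : ℂ}, IsArcLike P u v → IsClosed Q → IsClosed R →
      P ∩ Q = {u, v} → P ∩ R = {u, v} → Q ∪ R ⊆ P₁ ∪ P₂ ∪ P₃ → w ∈ P \ {u, v} →
      w ∈ closure O → u ∈ Q → v ∈ Q →
      ∀ p ∈ (Q ∪ R)ᶜ, IsBounded (connectedComponentIn (Q ∪ R)ᶜ p) →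
        connectedComponentIn (Q ∪ R)ᶜ p ⊆ Pᶜ := by
    intro P Q R w hP hQ hR hPQ hPR hsub hw hwO hu hv p hp hb x hx hxP
    have hxJ := connectedComponentIn_subset _ _ hx
    have hSJ : P \ {u, v} ⊆ (Q ∪ R)ᶜ := by
      rintro z ⟨hzP, hz⟩ (hzQ | hzR)
      · exact hz (hPQ ▸ ⟨hzP, hzQ⟩)
      · exact hz (hPR ▸ ⟨hzP, hzR⟩)
    have hxuv : x ∉ ({u, v} : Set ℂ) := by
      rintro (rfl | rfl)
      · exact hxJ (Or.inl hu)
      · exact hxJ (Or.inl hv)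
    refine not_isBounded_connectedComponentIn_of_mem_closure (hQ.union hR)
      hP.isPreconnected_interior hSJ hw hwO (fun z hz hzb => hO z hz
        (hzb.subset (connectedComponentIn_mono _ (compl_subset_compl.2 hsub)))) x ⟨hxP, hxuv⟩ ?_
    rwa [← connectedComponentIn_eq hx]
  have u₁ := h₁.joinedIn.source_mem
  have v₁ := h₁.joinedIn.target_mem
  have u₂ := h₂.joinedIn.source_mem
  have v₂ := h₂.joinedIn.target_mem
  have u₃ := h₃.joinedIn.source_mem
  have v₃ := h₃.joinedIn.target_mem
  obtain ⟨p, hp, hb⟩ := exists_isBounded_connectedComponentIn h₁.isCompact h₂.isCompact h₁.ne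
    h₁.joinedIn h₂.joinedIn h₁₂
  have hW₃ : connectedComponentIn (P₁ ∪ P₂)ᶜ p ⊆ P₃ᶜ :=
    outer h₃ c₁ c₂ (by rw [inter_comm, h₁₃]) (by rw [inter_comm, h₂₃])
      subset_union_left hw₃ hO₃ u₁ v₁ p hp hb
  have hpW := mem_connectedComponentIn hp
  have hpn := (c₁.union c₂).isOpen_compl.connectedComponentIn.mem_nhds hpW
  have hp₃ := hW₃ hpW
  rw [mem_compl_iff, mem_union, not_or] at hp
  have hp13 : p ∈ (P₁ ∪ P₃)ᶜ := by simp_all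
  have hp23 : p ∈ (P₂ ∪ P₃)ᶜ := by simp_all
  have hWJ : connectedComponentIn (P₁ ∪ P₂)ᶜ p ⊆ (P₁ ∪ P₂)ᶜ := connectedComponentIn_subset _ _
  have b₁₃ : ¬ IsBounded (connectedComponentIn (P₁ ∪ P₃)ᶜ p) := by
    intro hb'
    have h := outer h₂ c₁ c₃ (by rw [inter_comm, h₁₂]) h₂₃
      (union_subset_union_left _ subset_union_left) hw₂ hO₂ u₁ v₁ p hp13 hb'
    have h' := connectedComponentIn_subset (P₁ ∪ P₃)ᶜ p
    refine not_frontier_subset_of_hasLogOn h₁.isCompact (h₁.hasLogOn p hp.1) hb hpn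
      ((frontier_subset_inter_of_disjoint (c₁.union c₂) (c₁.union c₃) (by simp_all) hp13
        (fun z hz => ?_) (fun z hz => ?_)).trans ?_)
    · have := hWJ hz
      have := hW₃ hz
      simp_all
    · have := h hz
      have := h' hz
      simp_all
    · rw [← union_inter_distrib_left, h₂₃]
      exact union_subset subset_rfl (by rintro z (rfl | rfl) <;> assumption)
  have b₂₃ : ¬ IsBounded (connectedComponentIn (P₂ ∪ P₃)ᶜ p) := by
    intro hb'
    have h := outer h₁ c₂ c₃ h₁₂ h₁₃
      (union_subset_union_left _ subset_union_right) hw₁ hO₁ u₂ v₂ p hp23 hb'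
    have h' := connectedComponentIn_subset (P₂ ∪ P₃)ᶜ p
    refine not_frontier_subset_of_hasLogOn h₂.isCompact (h₂.hasLogOn p hp.2) hb hpn
      ((frontier_subset_inter_of_disjoint (c₁.union c₂) (c₂.union c₃) (by simp_all) hp23
        (fun z hz => ?_) (fun z hz => ?_)).trans ?_)
    · have := hWJ hz
      have := hW₃ hz
      simp_all
    · have := h hz
      have := h' hz
      simp_all
    · rw [union_comm P₁, ← union_inter_distrib_left, h₁₃]
      exact union_subset subset_rfl (by rintro z (rfl | rfl) <;> assumption)
  have l₁₃ := hasLogOn_sub_of_unbounded (h₁.isCompact.union h₃.isCompact)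
    isPreconnected_connectedComponentIn (connectedComponentIn_subset _ p) b₁₃
    (mem_connectedComponentIn hp13)
  have l₂₃ := hasLogOn_sub_of_unbounded (h₂.isCompact.union h₃.isCompact)
    isPreconnected_connectedComponentIn (connectedComponentIn_subset _ p) b₂₃
    (mem_connectedComponentIn hp23)
  have hint : (P₁ ∪ P₃) ∩ (P₂ ∪ P₃) = P₃ := by
    rw [← inter_union_distrib_right, h₁₂]
    exact union_eq_self_of_subset_left (by rintro z (rfl | rfl) <;> assumption)
  have l := HasLogOn.union (Or.inl ⟨c₁.union c₃, c₂.union c₃⟩)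
    (by rw [hint]; exact h₃.isPreconnected) l₁₃ l₂₃
  refine not_frontier_subset_of_hasLogOn ((h₁.isCompact.union h₃.isCompact).union
    (h₂.isCompact.union h₃.isCompact)) l hb hpn
    ((frontier_connectedComponentIn_compl_subset (c₁.union c₂) p).trans ?_)
  exact union_subset_union subset_union_left subset_union_left

/-! ### Theta subgraphs of outerplanar graphs -/

namespace SimpleGraph

variable {V : Type*} {G : SimpleGraph V}

/-- The part of a drawing that is covered by the edges of a walk. -/
def PlaneDrawing.walkCarrier (D : G.PlaneDrawing) {s t : V} (p : G.Walk s t) : Set ℂ :=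
  {z | ∃ e : G.edgeSet, (e : Sym2 V) ∈ p.edges ∧ z ∈ D.arc e}

theorem PlaneDrawing.walkCarrier_subset (D : G.PlaneDrawing) {s t : V} (p : G.Walk s t) :
    D.walkCarrier p ⊆ D.carrier := fun _ ⟨e, _, hz⟩ => Or.inr (mem_iUnion.2 ⟨e, hz⟩)

theorem PlaneDrawing.walkCarrier_cons (D : G.PlaneDrawing) {s w t : V} (h : G.Adj s w)
    (p : G.Walk w t) :
    D.walkCarrier (Walk.cons h p) = D.arc ⟨s(s, w), h⟩ ∪ D.walkCarrier p := by
  ext z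
  simp only [walkCarrier, Walk.edges_cons, List.mem_cons, mem_ofPred_eq, mem_union]
  constructor
  · rintro ⟨e, he | he, hz⟩
    · left; rwa [← show e = ⟨s(s, w), h⟩ from Subtype.ext he]
    · exact Or.inr ⟨e, he, hz⟩
  · rintro (hz | ⟨e, he, hz⟩)
    · exact ⟨_, Or.inl rfl, hz⟩
    · exact ⟨e, Or.inr he, hz⟩

theorem PlaneDrawing.walkCarrier_nil (D : G.PlaneDrawing) (s : V) :
    D.walkCarrier (Walk.nil : G.Walk s s) = ∅ := by
  ext z; simp [walkCarrier]

theorem mem_support_of_mem_edge {s t x : V} (p : G.Walk s t) {e : Sym2 V} (he : e ∈ p.edges)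
    (hx : x ∈ e) : x ∈ p.support := by
  induction e with
  | _ a b =>
    rcases Sym2.mem_iff.1 hx with rfl | rfl
    · exact p.fst_mem_support_of_mem_edges he
    · exact p.snd_mem_support_of_mem_edges he

theorem PlaneDrawing.isArcLike_walkCarrier (D : G.PlaneDrawing) {s t : V} (p : G.Walk s t)
    (hp : p.IsPath) (hn : p.length ≠ 0) :
    IsArcLike (D.walkCarrier p) (D.point s) (D.point t) := by
  induction p with
  | nil => simp at hn
  | @cons s w t h p ih =>
    rw [Walk.cons_isPath_iff] at hp
    obtain ⟨γ, hγ, hγr⟩ := D.arc_isArc s w h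
    have harc := hγr ▸ IsArcLike.of_path γ hγ
    rw [D.walkCarrier_cons]
    cases p with
    | nil => rw [walkCarrier_nil, union_empty]; exact harc
    | cons h' q =>
      have hq := ih hp.1 (by simp)
      refine harc.trans hq ?_
      refine Subset.antisymm ?_ (singleton_subset_iff.2
        ⟨harc.joinedIn.target_mem, hq.joinedIn.source_mem⟩)
      rintro z ⟨hz, f, hf, hzf⟩
      have hsf : s ∉ (f : Sym2 V) := fun hs => hp.2 (mem_support_of_mem_edge _ hf hs)
      have hne : (⟨s(s, w), h⟩ : G.edgeSet) ≠ f := by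
        rintro rfl; exact hsf (by simp)
      obtain ⟨x, rfl⟩ := D.arc_inter_arc _ _ hne ⟨hz, hzf⟩
      have hx := D.mem_of_point_mem_arc _ _ hz
      have hx' := D.mem_of_point_mem_arc _ _ hzf
      rcases Sym2.mem_iff.1 hx with rfl | rfl
      · exact absurd hx' hsf
      · rfl

theorem not_mem_edges_of_isPath {s t : V} {p : G.Walk s t} (hp : p.IsPath)
    (hl : 2 ≤ p.length) : s(s, t) ∉ p.edges := by
  intro h
  have h1 := hp.eq_snd_of_mem_edges h
  have := hp.getVert_injOn (x₁ := 1) (x₂ := p.length) (by simp only [mem_ofPred_eq]; lia) (by simp)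
    (by rw [Walk.getVert_length]; exact h1.symm)
  lia

theorem PlaneDrawing.walkCarrier_inter (D : G.PlaneDrawing) {s t : V} {p q : G.Walk s t}
    (hp : p.IsPath) (hq : q.IsPath) (hpl : 2 ≤ p.length) (hql : 2 ≤ q.length)
    (hpq : ∀ x ∈ p.support, x ∈ q.support → x = s ∨ x = t) :
    D.walkCarrier p ∩ D.walkCarrier q = {D.point s, D.point t} := by
  have ap := D.isArcLike_walkCarrier p hp (by lia)
  have aq := D.isArcLike_walkCarrier q hq (by lia)
  refine Subset.antisymm ?_ ?_
  · rintro z ⟨⟨e, he, hze⟩, f, hf, hzf⟩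
    have hef : e ≠ f := by
      rintro rfl
      obtain ⟨e, heG⟩ := e
      induction e with
      | _ a b =>
        have hab : a ≠ b := G.ne_of_adj heG
        have ha := hpq a (p.fst_mem_support_of_mem_edges he) (q.fst_mem_support_of_mem_edges hf)
        have hb := hpq b (p.snd_mem_support_of_mem_edges he) (q.snd_mem_support_of_mem_edges hf)
        rcases ha with rfl | rfl <;> rcases hb with rfl | rfl
        · exact hab rfl
        · exact not_mem_edges_of_isPath hp hpl he
        · exact not_mem_edges_of_isPath hp hpl (Sym2.eq_swap ▸ he)
        · exact hab rfl
    obtain ⟨x, rfl⟩ := D.arc_inter_arc _ _ hef ⟨hze, hzf⟩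
    rcases hpq x (mem_support_of_mem_edge _ he (D.mem_of_point_mem_arc _ _ hze))
      (mem_support_of_mem_edge _ hf (D.mem_of_point_mem_arc _ _ hzf)) with rfl | rfl
    · exact Or.inl rfl
    · exact Or.inr rfl
  · rintro z (rfl | rfl)
    · exact ⟨ap.joinedIn.source_mem, aq.joinedIn.source_mem⟩
    · exact ⟨ap.joinedIn.target_mem, aq.joinedIn.target_mem⟩

/-- `G` has no theta subgraph whose three paths all have an inner vertex, that is, no subdivision
of `K₂,₃`. -/
def ThetaFree (G : SimpleGraph V) : Prop :=
  ∀ (s t : V) (p₁ p₂ p₃ : G.Walk s t), p₁.IsPath → p₂.IsPath → p₃.IsPath →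
    2 ≤ p₁.length → 2 ≤ p₂.length → 2 ≤ p₃.length →
    (∀ x ∈ p₁.support, x ∈ p₂.support → x = s ∨ x = t) →
    (∀ x ∈ p₁.support, x ∈ p₃.support → x = s ∨ x = t) →
    (∀ x ∈ p₂.support, x ∈ p₃.support → x = s ∨ x = t) → False

theorem PlaneDrawing.exists_inner_point (D : G.PlaneDrawing) {s t : V} {p : G.Walk s t}
    (hp : p.IsPath) (hl : 2 ≤ p.length) :
    ∃ w, D.point w ∈ D.walkCarrier p \ {D.point s, D.point t} := by
  cases p with
  | nil => simp at hl
  | @cons _ w _ h q =>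
    have hq : q.length ≠ 0 := by
      simp only [Walk.length_cons] at hl; lia
    rw [Walk.cons_isPath_iff] at hp
    have aq := D.isArcLike_walkCarrier q hp.1 hq
    refine ⟨w, ?_, ?_⟩
    · rw [D.walkCarrier_cons]; exact Or.inr aq.joinedIn.source_mem
    · rintro (hs | ht)
      · exact G.ne_of_adj h (D.point_injective hs).symm
      · exact aq.ne ht

theorem IsOuterplanar.thetaFree (hG : G.IsOuterplanar) : G.ThetaFree := by
  obtain ⟨D, hD⟩ := hG
  intro s t p₁ p₂ p₃ h₁ h₂ h₃ l₁ l₂ l₃ h₁₂ h₁₃ h₂₃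
  have arc : ∀ {p : G.Walk s t}, p.IsPath → 2 ≤ p.length →
      IsArcLike (D.walkCarrier p) (D.point s) (D.point t) := fun hp hl =>
    D.isArcLike_walkCarrier _ hp (by lia)
  obtain ⟨w₁, hw₁⟩ := D.exists_inner_point h₁ l₁
  obtain ⟨w₂, hw₂⟩ := D.exists_inner_point h₂ l₂
  obtain ⟨w₃, hw₃⟩ := D.exists_inner_point h₃ l₃
  have hO : ∀ w, D.point w ∈ closure D.outerFace := fun w => frontier_subset_closure (hD w)
  refine theta_curve_not_outer (arc h₁ l₁) (arc h₂ l₂) (arc h₃ l₃)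
    (D.walkCarrier_inter h₁ h₂ l₁ l₂ h₁₂) (D.walkCarrier_inter h₁ h₃ l₁ l₃ h₁₃)
    (D.walkCarrier_inter h₂ h₃ l₂ l₃ h₂₃) (O := D.outerFace) (fun z hz hb => ?_) hw₁ hw₂ hw₃
    (hO _) (hO _) (hO _)
  exact hz.2 (hb.subset (connectedComponentIn_mono _ (compl_subset_compl.2
    (union_subset (union_subset (D.walkCarrier_subset _) (D.walkCarrier_subset _))
      (D.walkCarrier_subset _)))))

end SimpleGraph

end PlaneSeparation

/-! ### Peeling off long ears -/

namespace SimpleGraph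

variable {V : Type*} {G H : SimpleGraph V}

theorem ThetaFree.mono (hG : G.ThetaFree) (h : H ≤ G) : H.ThetaFree := by
  intro s t p₁ p₂ p₃ h₁ h₂ h₃ l₁ l₂ l₃ h₁₂ h₁₃ h₂₃
  refine hG s t (p₁.mapLe h) (p₂.mapLe h) (p₃.mapLe h) (h₁.mapLe h) (h₂.mapLe h) (h₃.mapLe h)
    ?_ ?_ ?_ ?_ ?_ ?_ <;> simpa

/-- A path whose ends are adjacent closes up to a cycle. -/
theorem le_length_add_one_of_isPath {u v : V} {p : G.Walk u v} (hp : p.IsPath) (hl : 2 ≤ p.length)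
    (h : G.Adj v u) {g : ℕ} (hg : g ≤ G.egirth) : g ≤ p.length + 1 := by
  have hc : (Walk.cons h p).IsCycle := by
    rw [Walk.isCycle_iff_isPath_tail_and_le_length]
    exact ⟨by simpa using hp, by simp; lia⟩
  have := le_egirth.1 hg _ _ hc
  simpa using (Nat.cast_le (α := ℕ∞)).1 (by simpa using this)

/-- A walk inside `A` from a neighbour of `s` to a neighbour of `t` yields a path from `s` to `t`
that has inner vertices, all of them in `A`. -/
theorem exists_isPath_through [DecidableEq V] {s t a b : V} {A : Set V} (w : G.Walk a b)
    (hw : ∀ x ∈ w.support, x ∈ A) (hs : s ∉ A) (ht : t ∉ A) (hst : s ≠ t) (hsa : G.Adj s a)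
    (hbt : G.Adj b t) : ∃ p : G.Walk s t, p.IsPath ∧ 2 ≤ p.length ∧
      ∀ x ∈ p.support, x = s ∨ x = t ∨ x ∈ A := by
  have hsub : ∀ x ∈ w.bypass.support, x ∈ A := fun x hx => hw x (w.support_bypass_subset_support hx)
  refine ⟨Walk.cons hsa (w.bypass.concat hbt), ?_, by simp, fun x hx => ?_⟩
  · rw [Walk.cons_isPath_iff]
    refine ⟨w.bypass_isPath.concat (fun h => ht (hsub _ h)) hbt, fun h => ?_⟩
    rw [Walk.support_concat] at h
    simp only [List.mem_append, List.mem_singleton] at h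
    rcases h with h | h
    · exact hs (hsub _ h)
    · exact hst h
  · rw [Walk.support_cons, Walk.support_concat] at hx
    simp only [List.mem_append, List.mem_cons, List.not_mem_nil,
      or_false] at hx
    rcases hx with h | h | h
    · exact Or.inl h
    · exact Or.inr (Or.inr (hsub _ h))
    · exact Or.inr (Or.inl h)

/-- Three disjoint sets, each of which contains a walk between a neighbour of `s` and a neighbour
of `t`, give a theta subgraph. -/
theorem ThetaFree.false_of_walks (hG : G.ThetaFree) {s t a₁ a₂ a₃ b₁ b₂ b₃ : V}
    {A₁ A₂ A₃ : Set V} (hst : s ≠ t) (w₁ : G.Walk a₁ b₁) (w₂ : G.Walk a₂ b₂) (w₃ : G.Walk a₃ b₃)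
    (h₁ : ∀ x ∈ w₁.support, x ∈ A₁) (h₂ : ∀ x ∈ w₂.support, x ∈ A₂)
    (h₃ : ∀ x ∈ w₃.support, x ∈ A₃) (hs₁ : s ∉ A₁) (hs₂ : s ∉ A₂) (hs₃ : s ∉ A₃)
    (ht₁ : t ∉ A₁) (ht₂ : t ∉ A₂) (ht₃ : t ∉ A₃) (sa₁ : G.Adj s a₁) (sa₂ : G.Adj s a₂)
    (sa₃ : G.Adj s a₃) (bt₁ : G.Adj b₁ t) (bt₂ : G.Adj b₂ t) (bt₃ : G.Adj b₃ t)
    (d₁₂ : Disjoint A₁ A₂) (d₁₃ : Disjoint A₁ A₃) (d₂₃ : Disjoint A₂ A₃) : False := by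
  classical
  obtain ⟨p₁, i₁, l₁, m₁⟩ := exists_isPath_through w₁ h₁ hs₁ ht₁ hst sa₁ bt₁
  obtain ⟨p₂, i₂, l₂, m₂⟩ := exists_isPath_through w₂ h₂ hs₂ ht₂ hst sa₂ bt₂
  obtain ⟨p₃, i₃, l₃, m₃⟩ := exists_isPath_through w₃ h₃ hs₃ ht₃ hst sa₃ bt₃
  have key : ∀ {A B : Set V} {x : V}, Disjoint A B → (x = s ∨ x = t ∨ x ∈ A) →
      (x = s ∨ x = t ∨ x ∈ B) → x = s ∨ x = t := by
    intro A B x hd hA hB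
    rcases hA with h | h | h
    · exact Or.inl h
    · exact Or.inr h
    · rcases hB with h' | h' | h'
      · exact Or.inl h'
      · exact Or.inr h'
      · exact absurd h' (Set.disjoint_left.1 hd h)
  exact hG s t p₁ p₂ p₃ i₁ i₂ i₃ l₁ l₂ l₃ (fun x hx hx' => key d₁₂ (m₁ x hx) (m₂ x hx'))
    (fun x hx hx' => key d₁₃ (m₁ x hx) (m₃ x hx')) (fun x hx hx' => key d₂₃ (m₂ x hx) (m₃ x hx'))

/-- The vertices outside `T` that have a neighbour in `T`. -/
def vertexBoundary (G : SimpleGraph V) (T : Finset V) : Set V :=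
  {w | w ∉ T ∧ ∃ s ∈ T, G.Adj s w}

/-- The vertices that can be reached from `z` inside `A`. -/
def reachableWithin (G : SimpleGraph V) (A : Set V) (z : V) : Set V :=
  {x | ∃ w : G.Walk z x, ∀ y ∈ w.support, y ∈ A}

theorem mem_reachableWithin_of_adj {A : Set V} {z x y : V} (hx : x ∈ G.reachableWithin A z)
    (hxy : G.Adj x y) (hy : y ∈ A) : y ∈ G.reachableWithin A z := by
  obtain ⟨w, hw⟩ := hx
  refine ⟨w.concat hxy, fun v hv => ?_⟩
  rw [Walk.support_concat] at hv
  simp only [List.mem_append, List.mem_singleton] at hv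
  rcases hv with h | rfl
  · exact hw v h
  · exact hy

theorem reachableWithin_subset {A : Set V} {z : V} : G.reachableWithin A z ⊆ A :=
  fun _ ⟨w, hw⟩ => hw _ w.end_mem_support

theorem exists_walk_of_mem_reachableWithin {A : Set V} {z x y : V}
    (hx : x ∈ G.reachableWithin A z) (hy : y ∈ G.reachableWithin A z) :
    ∃ w : G.Walk x y, ∀ v ∈ w.support, v ∈ G.reachableWithin A z := by
  classical
  obtain ⟨p, hp⟩ := hx
  obtain ⟨q, hq⟩ := hy
  have key : ∀ {x : V} (p : G.Walk z x), (∀ v ∈ p.support, v ∈ A) →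
      ∀ v ∈ p.support, v ∈ G.reachableWithin A z := fun p hp v hv =>
    ⟨p.takeUntil v hv, fun y hy => hp y (p.support_takeUntil_subset_support hv hy)⟩
  refine ⟨p.reverse.append q, fun v hv => ?_⟩
  rcases (Walk.mem_support_append_iff _ _).1 hv with h | h
  · exact key p hp v (by simpa using h)
  · exact key q hq v h

/-- The vertices `f i, …, f j` of a path form a walk. -/
theorem exists_walk_of_forall_adj {f : ℕ → V} {i j : ℕ} (hij : i ≤ j)
    (h : ∀ k, i ≤ k → k < j → G.Adj (f k) (f (k + 1))) :
    ∃ w : G.Walk (f i) (f j), ∀ x ∈ w.support, ∃ k, i ≤ k ∧ k ≤ j ∧ x = f k := by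
  induction j, hij using Nat.le_induction with
  | base => exact ⟨Walk.nil, fun x hx => ⟨i, le_rfl, le_rfl, by simpa using hx⟩⟩
  | succ j hij ih =>
    obtain ⟨w, hw⟩ := ih fun k h1 h2 => h k h1 (by lia)
    refine ⟨w.concat (h j hij (by lia)), fun x hx => ?_⟩
    rw [Walk.support_concat] at hx
    simp only [List.mem_append, List.mem_singleton] at hx
    rcases hx with hx | rfl
    · obtain ⟨k, h1, h2, h3⟩ := hw x hx
      exact ⟨k, h1, by lia, h3⟩
    · exact ⟨j + 1, by lia, le_rfl, rfl⟩

/-- In a theta-free graph, a connected set `A` off a cycle `f 0, …, f n` has no two nonadjacent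
neighbours on the cycle, since `A` and the two parts of the cycle would form a theta subgraph. -/
theorem ThetaFree.adj_of_cycle (hG : G.ThetaFree) {f : ℕ → V} {n : ℕ}
    (hinj : ∀ i j, i ≤ n → j ≤ n → f i = f j → i = j)
    (hadj : ∀ k < n, G.Adj (f k) (f (k + 1))) (hclose : G.Adj (f n) (f 0)) {A : Set V}
    (hA : ∀ k ≤ n, f k ∉ A) {a b : V} (w : G.Walk a b) (hw : ∀ x ∈ w.support, x ∈ A) {i j : ℕ}
    (hij : i < j) (hj : j ≤ n) (hia : G.Adj (f i) a) (hbj : G.Adj b (f j)) :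
    G.Adj (f i) (f j) := by
  by_contra hnadj
  have hij2 : i + 2 ≤ j := by
    by_contra h
    obtain rfl : j = i + 1 := by lia
    exact hnadj (hadj i (by lia))
  have hends : ¬ (i = 0 ∧ j = n) := by
    rintro ⟨rfl, rfl⟩; exact hnadj hclose.symm
  obtain ⟨w₁, h₁⟩ := exists_walk_of_forall_adj (G := G) (f := f) (i := i + 1) (j := j - 1)
    (by lia) (fun k _ _ => hadj k (by lia))
  let A₁ : Set V := {x | ∃ k, i < k ∧ k < j ∧ x = f k}
  let A₂ : Set V := {x | ∃ k, (k < i ∨ (j < k ∧ k ≤ n)) ∧ x = f k}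
  have hA₁ : ∀ k ≤ n, f k ∈ A₁ → i < k ∧ k < j := by
    rintro k hk ⟨l, h1, h2, h3⟩
    obtain rfl := hinj k l hk (by lia) h3
    exact ⟨h1, h2⟩
  have hA₂ : ∀ k ≤ n, f k ∈ A₂ → k < i ∨ j < k := by
    rintro k hk ⟨l, h1, h3⟩
    obtain rfl := hinj k l hk (by lia) h3
    lia
  obtain ⟨a₂, b₂, w₂, h₂, ha₂, hb₂⟩ : ∃ (a₂ b₂ : V) (w₂ : G.Walk a₂ b₂),
      (∀ x ∈ w₂.support, x ∈ A₂) ∧ G.Adj (f i) a₂ ∧ G.Adj b₂ (f j) := by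
    have left : 0 < i → ∃ w : G.Walk (f (i - 1)) (f 0), ∀ x ∈ w.support, x ∈ A₂ := fun hi => by
      obtain ⟨w, hw⟩ := exists_walk_of_forall_adj (G := G) (f := f) (i := 0) (j := i - 1)
        (by lia) (fun k _ _ => hadj k (by lia))
      refine ⟨w.reverse, fun x hx => ?_⟩
      obtain ⟨k, h1, h2, h3⟩ := hw x (by simpa using hx)
      exact ⟨k, Or.inl (by lia), h3⟩
    have right : j < n → ∃ w : G.Walk (f n) (f (j + 1)), ∀ x ∈ w.support, x ∈ A₂ := fun hi => by
      obtain ⟨w, hw⟩ := exists_walk_of_forall_adj (G := G) (f := f) (i := j + 1) (j := n)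
        (by lia) (fun k _ _ => hadj k (by lia))
      refine ⟨w.reverse, fun x hx => ?_⟩
      obtain ⟨k, h1, h2, h3⟩ := hw x (by simpa using hx)
      exact ⟨k, Or.inr (by lia), h3⟩
    have hi' : 0 < i → G.Adj (f i) (f (i - 1)) := fun hi => by
      have := hadj (i - 1) (by lia)
      rw [Nat.sub_add_cancel hi] at this
      exact this.symm
    rcases Nat.eq_zero_or_pos i with hi | hi
    · obtain ⟨w, hw⟩ := right (by lia)
      exact ⟨_, _, w, hw, hi ▸ hclose.symm, (hadj j (by lia)).symm⟩
    · obtain ⟨w, hw⟩ := left hi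
      rcases hj.eq_or_lt with hn | hn
      · exact ⟨_, _, w, hw, hi' hi, hn ▸ hclose.symm⟩
      · obtain ⟨w', hw'⟩ := right hn
        refine ⟨_, _, w.append (Walk.cons hclose.symm w'), fun x hx => ?_, hi' hi,
          (hadj j hn).symm⟩
        rcases (Walk.mem_support_append_iff _ _).1 hx with h | h
        · exact hw x h
        · rw [Walk.support_cons, List.mem_cons] at h
          rcases h with rfl | h
          · exact hw _ w.end_mem_support
          · exact hw' x h
  refine hG.false_of_walks (A₁ := A₁) (A₂ := A₂) (A₃ := A)
    (fun h => by have := hinj i j (by lia) hj h; lia)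
    w₁ w₂ w (fun x hx => ?_) h₂ hw
    (fun h => by have := hA₁ i (by lia) h; lia) (fun h => by have := hA₂ i (by lia) h; lia)
    (hA i (by lia)) (fun h => by have := hA₁ j hj h; lia)
    (fun h => by have := hA₂ j hj h; lia) (hA j hj)
    (hadj i (by lia)) ha₂ hia ?_ hb₂ hbj ?_ ?_ ?_
  · obtain ⟨k, h1, h2, h3⟩ := h₁ x hx
    exact ⟨k, by lia, by lia, h3⟩
  · have := hadj (j - 1) (by lia)
    rwa [Nat.sub_add_cancel (by lia)] at this
  · rw [Set.disjoint_left]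
    rintro x ⟨k, h1, h2, rfl⟩ h
    have := hA₂ k (by lia) h
    lia
  · rw [Set.disjoint_left]
    rintro x ⟨k, h1, h2, rfl⟩ h
    exact hA k (by lia) h
  · rw [Set.disjoint_left]
    rintro x ⟨k, h1, rfl⟩ h
    exact hA k (by lia) h

/-- An *ear* of length `n` in `T`: a path `f 0, …, f n` all of whose inner vertices lie in `T`
and have no neighbours except the two next to them on the path. -/
structure IsEar (G : SimpleGraph V) (T : Finset V) (n : ℕ) (f : ℕ → V) : Prop where
  inj : ∀ i j, i ≤ n → j ≤ n → f i = f j → i = j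
  adj : ∀ k < n, G.Adj (f k) (f (k + 1))
  mem : ∀ k, 0 < k → k < n → f k ∈ T
  eq_of_adj : ∀ k, 0 < k → k < n → ∀ y, G.Adj (f k) y → y = f (k - 1) ∨ y = f (k + 1)

/-- The step of `exists_leaf_or_ear` in which the boundary of `T` consists of two adjacent
vertices `u` and `v` and no smaller set has a boundary that is a clique. Take a shortest path from
`u` to `v` with its inner vertices in `T`. It has no chord, and it covers `T`: the boundary of a
component of the rest would be a clique by `ThetaFree.adj_of_cycle`. -/
theorem ThetaFree.exists_ear_of_minimal (hG : G.ThetaFree) {g : ℕ} (hg : g ≤ G.egirth)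
    (hg5 : 5 ≤ g) {T : Finset V}
    (hmin : ∀ T' ⊂ T, T'.Nonempty → ¬ G.IsClique (G.vertexBoundary T')) {u v : V}
    (hu : u ∈ G.vertexBoundary T) (hv : v ∈ G.vertexBoundary T) (huv : G.Adj u v)
    (hbd : ∀ w ∈ G.vertexBoundary T, w = u ∨ w = v) : ∃ f, G.IsEar T (g - 1) f := by
  classical
  have hcl : G.IsClique (G.vertexBoundary T) := by
    intro x hx y hy hxy
    rcases hbd x hx with rfl | rfl <;> rcases hbd y hy with rfl | rfl
    · exact absurd rfl hxy
    · exact huv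
    · exact huv.symm
    · exact absurd rfl hxy
  obtain ⟨huT, a, haT, hau⟩ := hu
  obtain ⟨hvT, b, hbT, hbv⟩ := hv
  -- `T` is connected, as the boundary of a component is contained in the boundary of `T`
  have hconn : ∀ x ∈ T, x ∈ G.reachableWithin (T : Set V) a := by
    by_contra! h
    obtain ⟨x, hxT, hx⟩ := h
    refine hmin (T.filter (· ∈ G.reachableWithin (T : Set V) a)) ?_ ⟨a, ?_⟩ ?_
    · exact Finset.filter_ssubset.2 ⟨x, hxT, hx⟩
    · rw [Finset.mem_filter]
      exact ⟨haT, Walk.nil, by simpa using haT⟩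
    · refine hcl.subset ?_
      rintro w ⟨hw, s, hs, hsw⟩
      rw [Finset.mem_filter] at hw hs
      refine ⟨fun hwT => hw ⟨hwT, mem_reachableWithin_of_adj hs.2 hsw hwT⟩, s, hs.1, hsw⟩
  let H : SimpleGraph V :=
    { Adj := fun x y => G.Adj x y ∧ (x ∈ T ∨ y ∈ T)
      symm := ⟨fun _ _ h => ⟨h.1.symm, h.2.symm⟩⟩
      loopless := ⟨fun _ h => G.loopless.irrefl _ h.1⟩ }
  have hHG : H ≤ G := fun _ _ h => h.1
  have hreach : H.Reachable u v := by
    obtain ⟨w, hw⟩ := hconn b hbT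
    have h1 : H.Walk a b := w.transfer H fun e he => by
      induction e with
      | _ x y => exact ⟨w.adj_of_mem_edges he, Or.inl (hw x (w.fst_mem_support_of_mem_edges he))⟩
    have h2 : H.Adj u a := ⟨hau.symm, Or.inr haT⟩
    have h3 : H.Adj b v := ⟨hbv, Or.inl hbT⟩
    exact ⟨Walk.cons h2 (h1.concat h3)⟩
  obtain ⟨p, hp, hpd⟩ := hreach.exists_path_of_dist
  set n := p.length with hn
  have hinj : ∀ i j, i ≤ n → j ≤ n → p.getVert i = p.getVert j → i = j := fun i j hi hj h =>
    hp.getVert_injOn hi hj h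
  have hadj : ∀ k < n, H.Adj (p.getVert k) (p.getVert (k + 1)) := fun k hk =>
    p.adj_getVert_succ hk
  have h0 : p.getVert 0 = u := p.getVert_zero
  have hpn : p.getVert n = v := p.getVert_length
  have hn2 : 2 ≤ n := by
    by_contra h
    have hn0 : n ≠ 0 := fun h => huv.ne (h0.symm.trans ((congrArg p.getVert h.symm).trans hpn))
    have := hadj 0 (by lia)
    rw [h0, zero_add, show 1 = n by lia, hpn] at this
    rcases this.2 with h | h
    · exact huT h
    · exact hvT h
  have hgn : g ≤ n + 1 := by
    have := le_length_add_one_of_isPath (hp.mapLe hHG) (by simpa using hn2) huv.symm hg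
    simpa using this
  have hmem : ∀ k, 0 < k → k < n → p.getVert k ∈ T := by
    intro k hk hkn
    by_contra hkT
    have hadj' := hadj k hkn
    have := hbd _ ⟨hkT, _, hadj'.2.resolve_left hkT, hadj'.1.symm⟩
    rcases this with h | h
    · have := hinj k 0 (by lia) (by lia) (h.trans h0.symm); lia
    · have := hinj k n (by lia) (by lia) (h.trans hpn.symm); lia
  have hchord : ∀ i j, i ≤ n → j ≤ n → H.Adj (p.getVert i) (p.getVert j) → j ≤ i + 1 := by
    intro i j hi hj h
    have := H.dist_le ((p.take i).append (Walk.cons h (p.drop j)))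
    rw [← hpd] at this
    simp only [Walk.length_append, Walk.length_cons, Walk.take_length, Walk.drop_length] at this
    lia
  have hclose : G.Adj (p.getVert n) (p.getVert 0) := by rw [h0, hpn]; exact huv.symm
  have hcover : ∀ x ∈ T, ∃ k ≤ n, x = p.getVert k := by
    by_contra! h
    obtain ⟨z, hzT, hz⟩ := h
    let S : Set V := {x | x ∈ T ∧ ∀ k ≤ n, x ≠ p.getVert k}
    let D := T.filter (· ∈ G.reachableWithin S z)
    have hD : ∀ x, x ∈ D ↔ x ∈ G.reachableWithin S z := fun x => by
      simp only [D, Finset.mem_filter, and_iff_right_iff_imp]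
      exact fun h => (reachableWithin_subset h).1
    refine hmin D ?_ ⟨z, ?_⟩ ?_
    · refine Finset.filter_ssubset.2 ⟨_, hmem 1 (by lia) (by lia), fun h => ?_⟩
      exact (reachableWithin_subset h).2 1 (by lia) rfl
    · rw [hD]
      refine ⟨Walk.nil, fun y hy => ?_⟩
      obtain rfl : y = z := by simpa using hy
      exact ⟨hzT, hz⟩
    · have hDb : ∀ w ∈ G.vertexBoundary D, ∃ k ≤ n, w = p.getVert k := by
        rintro w ⟨hw, s, hs, hsw⟩
        rw [hD] at hw hs
        by_contra! h
        by_cases hwT : w ∈ T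
        · exact hw (mem_reachableWithin_of_adj hs hsw ⟨hwT, h⟩)
        · rcases hbd w ⟨hwT, s, (reachableWithin_subset hs).1, hsw⟩ with rfl | rfl
          · exact h 0 (by lia) h0.symm
          · exact h n le_rfl hpn.symm
      have key : ∀ i j, i < j → j ≤ n → p.getVert i ∈ G.vertexBoundary D →
          p.getVert j ∈ G.vertexBoundary D → G.Adj (p.getVert i) (p.getVert j) := by
        rintro i j hij hj ⟨-, s, hs, hsi⟩ ⟨-, t, ht, htj⟩
        rw [hD] at hs ht
        obtain ⟨w, hw⟩ := exists_walk_of_mem_reachableWithin hs ht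
        exact hG.adj_of_cycle hinj (fun k hk => (hadj k hk).1) hclose
          (fun k hk h => (reachableWithin_subset h).2 k hk rfl) w hw hij hj hsi.symm htj
      intro x hx y hy hxy
      obtain ⟨i, hi, rfl⟩ := hDb x hx
      obtain ⟨j, hj, rfl⟩ := hDb y hy
      rcases lt_trichotomy i j with h | h | h
      · exact key i j h hj hx hy
      · exact absurd (h ▸ rfl) hxy
      · exact (key j i h hi hy hx).symm
  refine ⟨p.getVert, fun i j hi hj => hinj i j (by lia) (by lia), fun k hk =>
    (hadj k (by lia)).1, fun k h1 h2 => hmem k h1 (by lia), fun k h1 h2 y hy => ?_⟩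
  have hkT := hmem k h1 (by lia)
  obtain ⟨j, hj, rfl⟩ : ∃ j ≤ n, y = p.getVert j := by
    by_cases hyT : y ∈ T
    · exact hcover y hyT
    · rcases hbd y ⟨hyT, _, hkT, hy⟩ with rfl | rfl
      · exact ⟨0, by lia, h0.symm⟩
      · exact ⟨n, le_rfl, hpn.symm⟩
  have c₁ := hchord k j (by lia) hj ⟨hy, Or.inl hkT⟩
  have c₂ := hchord j k hj (by lia) ⟨hy.symm, Or.inr hkT⟩
  have : j ≠ k := fun h => G.loopless.irrefl _ (h ▸ hy)
  rcases (by lia : j = k - 1 ∨ j = k + 1) with rfl | rfl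
  · exact Or.inl rfl
  · exact Or.inr rfl

/-- In a theta-free graph of girth at least `g`, a nonempty set of vertices whose boundary is a
clique contains a vertex of degree at most one or the inner vertices of an ear of
length `g - 1`. -/
theorem ThetaFree.exists_leaf_or_ear (hG : G.ThetaFree) {g : ℕ} (hg : g ≤ G.egirth)
    (hg5 : 5 ≤ g) (T : Finset V) (hT : T.Nonempty) (hcl : G.IsClique (G.vertexBoundary T)) :
    (∃ x ∈ T, ∀ y z, G.Adj x y → G.Adj x z → y = z) ∨ ∃ f, G.IsEar T (g - 1) f := by
  classical
  induction T using Finset.strongInduction with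
  | H T ih =>
  by_contra hcon
  have hmin : ∀ T' ⊂ T, T'.Nonempty → ¬ G.IsClique (G.vertexBoundary T') := by
    intro T' hT' hne hcl'
    refine hcon ((ih T' hT' hne hcl').imp ?_ ?_)
    · rintro ⟨x, hx, h⟩
      exact ⟨x, hT'.1 hx, h⟩
    · rintro ⟨f, hf⟩
      exact ⟨f, { hf with mem := fun k h1 h2 => hT'.1 (hf.mem k h1 h2) }⟩
  rw [not_or] at hcon
  obtain ⟨hdeg, hear⟩ := hcon
  push Not at hdeg
  -- removing from `T` a vertex that is adjacent to all of a small boundary leaves a clique boundary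
  have hsmall : ∀ x ∈ T, (∀ w ∈ G.vertexBoundary T, G.Adj x w) →
      ¬ (G.vertexBoundary T).Subsingleton := by
    intro x hx hadj hsub
    obtain ⟨y, z, hxy, hxz, hyz⟩ := hdeg x hx
    refine hmin (T.erase x) (Finset.erase_ssubset hx) ?_ ?_
    · by_cases hy : y ∈ T
      · exact ⟨y, Finset.mem_erase.2 ⟨hxy.ne', hy⟩⟩
      · by_cases hz : z ∈ T
        · exact ⟨z, Finset.mem_erase.2 ⟨hxz.ne', hz⟩⟩
        · exact absurd (hsub ⟨hy, x, hx, hxy⟩ ⟨hz, x, hx, hxz⟩) hyz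
    · have hb : ∀ w ∈ G.vertexBoundary (T.erase x), w = x ∨ w ∈ G.vertexBoundary T := by
        rintro w ⟨hw, s, hs, hsw⟩
        rw [Finset.mem_erase] at hw hs
        by_cases h : w = x
        · exact Or.inl h
        · exact Or.inr ⟨fun hwT => hw ⟨h, hwT⟩, s, hs.2, hsw⟩
      intro w hw w' hw' hne
      rcases hb w hw with rfl | h <;> rcases hb w' hw' with rfl | h'
      · exact absurd rfl hne
      · exact hadj _ h'
      · exact (hadj _ h).symm
      · exact absurd (hsub h h') hne
  obtain ⟨x, hx⟩ := hT
  obtain ⟨u, hu⟩ : (G.vertexBoundary T).Nonempty := by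
    by_contra! h
    exact hsmall x hx (by simp [h]) (by simp [h])
  obtain ⟨v, hv, hvu⟩ : ∃ v ∈ G.vertexBoundary T, v ≠ u := by
    by_contra! h
    obtain ⟨y, hy, hyu⟩ := hu.2
    exact hsmall y hy (fun w hw => by rw [h w hw]; exact hyu)
      (fun w hw w' hw' => (h w hw).trans (h w' hw').symm)
  have huv : G.Adj u v := hcl hu hv hvu.symm
  refine hear (hG.exists_ear_of_minimal hg hg5 hmin hu hv huv fun w hw => ?_)
  by_contra! h
  -- otherwise `u`, `v`, `w` is a triangle
  have hwu := hcl hw hu h.1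
  have hvw := hcl hv hw h.2.symm
  have := le_length_add_one_of_isPath (p := Walk.cons huv (Walk.cons hvw Walk.nil))
    (by simp [Walk.cons_isPath_iff, h.1.symm, h.2.symm, hvu.symm]) (by simp) hwu hg
  simp at this
  lia

end SimpleGraph

/-! ### Extending colorings along a path -/

section PathColoring

variable {α : Type*}

/-- Choose from outside `M` as long as possible. -/
theorem exists_subset_card_inter_le [DecidableEq α] (A M : Finset α) {b : ℕ} (h : b ≤ A.card) :
    ∃ S ⊆ A, S.card = b ∧ (S ∩ M).card ≤ b - (A \ M).card := by
  by_cases hb : b ≤ (A \ M).card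
  · obtain ⟨S, hS, hSb⟩ := Finset.exists_subset_card_eq hb
    refine ⟨S, hS.trans Finset.sdiff_subset, hSb, ?_⟩
    have : S ∩ M = ∅ := Finset.disjoint_iff_inter_eq_empty.1
      (Finset.disjoint_of_subset_left hS Finset.sdiff_disjoint)
    simp [this]
  · obtain ⟨S, hS, hSA, hSb⟩ := Finset.exists_subsuperset_card_eq
      (Finset.sdiff_subset : A \ M ⊆ A) (not_le.1 hb).le h
    refine ⟨S, hSA, hSb, ?_⟩
    have h1 := Finset.card_sdiff_add_card_inter S M
    have h2 : (A \ M).card ≤ (S \ M).card := Finset.card_le_card fun x hx =>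
      Finset.mem_sdiff.2 ⟨hS hx, (Finset.mem_sdiff.1 hx).2⟩
    omega

/-- `φ` colors the vertices `1, …, j` of a path with `b` colors each from the lists `L`, in such
a way that consecutive vertices get disjoint sets; `φ 0` is an arbitrary prescribed set. -/
structure IsPathColoring (L : ℕ → Finset α) (b j : ℕ) (φ : ℕ → Finset α) : Prop where
  subset : ∀ i, 0 < i → i ≤ j → φ i ⊆ L i
  card : ∀ i, 0 < i → i ≤ j → (φ i).card = b
  disjoint : ∀ i < j, Disjoint (φ i) (φ (i + 1))

theorem IsPathColoring.zero (L : ℕ → Finset α) (b : ℕ) (φ : ℕ → Finset α) :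
    IsPathColoring L b 0 φ :=
  ⟨fun _ _ _ => by omega, fun _ _ _ => by omega, fun _ _ => by omega⟩

theorem IsPathColoring.extend {L : ℕ → Finset α} {b j : ℕ} {φ : ℕ → Finset α}
    (h : IsPathColoring L b j φ) {S : Finset α} (hS : S ⊆ L (j + 1)) (hSb : S.card = b)
    (hd : Disjoint (φ j) S) : ∃ ψ, IsPathColoring L b (j + 1) ψ ∧ ψ (j + 1) = S ∧
      ∀ i ≤ j, ψ i = φ i := by
  have hold : ∀ i ≤ j, Function.update φ (j + 1) S i = φ i := fun i hi =>
    Function.update_of_ne (by omega) _ _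
  have hnew : Function.update φ (j + 1) S (j + 1) = S := Function.update_self _ _ _
  refine ⟨Function.update φ (j + 1) S, ⟨fun i h0 hi => ?_, fun i h0 hi => ?_, fun i hi => ?_⟩,
    hnew, hold⟩
  · rcases Nat.le_succ_iff.1 hi with hi | rfl
    · rw [hold i hi]; exact h.subset i h0 hi
    · rwa [hnew]
  · rcases Nat.le_succ_iff.1 hi with hi | rfl
    · rw [hold i hi]; exact h.card i h0 hi
    · rwa [hnew]
  · rcases (Nat.lt_succ_iff.1 hi).lt_or_eq with hi | rfl
    · rw [hold i (by omega), hold (i + 1) (by omega)]; exact h.disjoint i hi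
    · rwa [hnew, hold _ le_rfl]

variable [DecidableEq α]

/-- Color a vertex with list `A`, given the color set `P` of its predecessor, with as few colors
as possible from `M`. -/
theorem exists_color_avoiding {A P M : Finset α} {b t m : ℕ} (hP : (P ∩ A).card ≤ t)
    (hM : (A ∩ M).card ≤ m) (ht : t + b ≤ A.card) :
    ∃ S ⊆ A, S.card = b ∧ Disjoint P S ∧ (S ∩ M).card ≤ m + t - (A.card - b) := by
  have h1 := Finset.card_sdiff_add_card_inter A P
  rw [Finset.inter_comm] at h1
  obtain ⟨S, hS, hSb, hSM⟩ := exists_subset_card_inter_le (A \ P) M (b := b) (by omega)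
  refine ⟨S, hS.trans Finset.sdiff_subset, hSb,
    (Finset.disjoint_of_subset_left hS Finset.sdiff_disjoint).symm, hSM.trans ?_⟩
  have h2 := Finset.card_sdiff_add_card_inter (A \ P) M
  have h3 : ((A \ P) ∩ M).card ≤ (A ∩ M).card :=
    Finset.card_le_card (Finset.inter_subset_inter_right Finset.sdiff_subset)
  omega

/-- Greedy coloring: if each vertex saves colors for its successor, the number of colors of the
next list that are in use decreases by `(a - b) - c` in every step. -/
theorem exists_isPathColoring_greedy {L : ℕ → Finset α} {a b c s : ℕ} (hs : s ≤ c)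
    (hc : c + b ≤ a) {C : Finset α} (hC : (C ∩ L 1).card ≤ s) (j : ℕ)
    (hL : ∀ i, 0 < i → i ≤ j → (L i).card = a)
    (hsep : ∀ i, 0 < i → i ≤ j → (L i ∩ L (i + 1)).card ≤ c) :
    ∃ φ, φ 0 = C ∧ IsPathColoring L b j φ ∧
      (φ j ∩ L (j + 1)).card ≤ s + j * c - j * (a - b) := by
  induction j with
  | zero => exact ⟨fun _ => C, rfl, .zero _ _ _, by simpa using hC⟩
  | succ j ih =>
    obtain ⟨φ, h0, hφ, hcard⟩ := ih (fun i h0 hi => hL i h0 (by omega))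
      (fun i h0 hi => hsep i h0 (by omega))
    have hmul : j * c ≤ j * (a - b) := Nat.mul_le_mul_left _ (by omega)
    have hLj := hL (j + 1) (by omega) le_rfl
    obtain ⟨S, hS, hSb, hd, hSM⟩ := exists_color_avoiding (b := b) hcard
      (hsep (j + 1) (by omega) le_rfl) (by omega)
    obtain ⟨ψ, hψ, hψS, hold⟩ := hφ.extend hS hSb hd
    refine ⟨ψ, (hold 0 (by omega)).trans h0, hψ, ?_⟩
    rw [hψS]
    refine hSM.trans ?_
    rw [hLj, Nat.succ_mul, Nat.succ_mul]
    omega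

/-- A target set `D` can be propagated two vertices back: if `L''` and `L` are the lists of the two
preceding vertices, then there is a target `D'` in `L''` such that `D'` and `D` together contain at
most `b` colors of `L`. -/
theorem exists_backward_target {L L'' D : Finset α} {a b : ℕ} (hL : L.card = a)
    (hL'' : L''.card = a) (hD : D.card ≤ b) (hb : b ≤ a) :
    ∃ D' ⊆ L'', D'.card = b ∧ (D ∩ L).card + (D' ∩ (L \ D)).card ≤ b := by
  obtain ⟨D', h1, h2, h3⟩ := exists_subset_card_inter_le L'' (L \ D) (b := b) (by omega)
  refine ⟨D', h1, h2, ?_⟩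
  have h4 := Finset.card_sdiff_add_card_inter L D
  rw [Finset.inter_comm] at h4
  have h5 := Finset.le_card_sdiff (L \ D) L''
  have h6 := Finset.card_le_card (Finset.inter_subset_left : D ∩ L ⊆ D)
  omega

/-- Exchange at most `n` elements of `D` for elements of `B` so as to lower the intersection
with `M`. -/
theorem exists_exchange {B D : Finset α} (M : Finset α) (hD : D ⊆ B) (n : ℕ) :
    ∃ S ⊆ B, S.card = D.card ∧ (S \ D).card ≤ n ∧
      (S ∩ M).card ≤ max ((D ∩ M).card - n) (D.card - (B \ M).card) := by
  have h1 : ∃ i, i = min n (min (D ∩ M).card ((B \ M) \ D).card) := ⟨_, rfl⟩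
  obtain ⟨i, hi⟩ := h1
  obtain ⟨X, hX, hXi⟩ := Finset.exists_subset_card_eq (s := D ∩ M) (n := i) (by omega)
  obtain ⟨Y, hY, hYi⟩ := Finset.exists_subset_card_eq (s := (B \ M) \ D) (n := i) (by omega)
  have hXD : X ⊆ D := hX.trans Finset.inter_subset_left
  have hdis : Disjoint (D \ X) Y := Finset.disjoint_left.2 fun x hx hy =>
    (Finset.mem_sdiff.1 (hY hy)).2 (Finset.mem_sdiff.1 hx).1
  refine ⟨D \ X ∪ Y, ?_, ?_, ?_, ?_⟩
  · exact Finset.union_subset (Finset.sdiff_subset.trans hD)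
      (hY.trans (Finset.sdiff_subset.trans Finset.sdiff_subset))
  · rw [Finset.card_union_of_disjoint hdis, Finset.card_sdiff_of_subset hXD]
    have := Finset.card_le_card hXD
    omega
  · refine (Finset.card_le_card (t := Y) fun x hx => ?_).trans (by omega)
    simp only [Finset.mem_sdiff, Finset.mem_union] at hx
    tauto
  · have h2 : (D \ X ∪ Y) ∩ M = (D ∩ M) \ X := by
      ext x
      have := @hY x
      simp only [Finset.mem_sdiff, Finset.mem_union, Finset.mem_inter] at this ⊢
      tauto
    rw [h2, Finset.card_sdiff_of_subset hX]
    have h3 := Finset.card_sdiff_add_card_inter D M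
    have h4 : (B \ M).card = ((B \ M) \ D).card + (D \ M).card := by
      rw [← Finset.card_sdiff_add_card_inter (B \ M) D]
      congr 2
      ext x
      have := @hD x
      simp only [Finset.mem_sdiff, Finset.mem_inter]
      tauto
    omega

theorem card_inter_add_card_inter_sdiff (A B L : Finset α) :
    (A ∩ L).card + (B ∩ (L \ A)).card = ((A ∪ B) ∩ L).card := by
  rw [← Finset.card_union_of_disjoint]
  · congr 1
    ext x
    simp only [Finset.mem_sdiff, Finset.mem_union, Finset.mem_inter]
    tauto
  · exact Finset.disjoint_left.2 fun x hx hy => by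
      simp only [Finset.mem_sdiff, Finset.mem_inter] at hx hy
      tauto

/-- Two steps along the path: the difference to the target drops by `a - 2 b`. -/
theorem exists_color_toward {L L' P D D' : Finset α} {a b r : ℕ} (hL : L.card = a)
    (hL' : L'.card = a) (hab : 2 * b ≤ a) (hP : P.card ≤ b) (hD : D ⊆ L') (hDb : D.card = b)
    (hD' : (D ∩ L).card + (D' ∩ (L \ D)).card ≤ b) (hr : (P \ D').card ≤ r) :
    ∃ S ⊆ L, ∃ S' ⊆ L', S.card = b ∧ S'.card = b ∧ Disjoint P S ∧ Disjoint S S' ∧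
      (S' \ D).card ≤ r - (a - 2 * b) := by
  obtain ⟨S', hS', hS'b, hS'D, hS'M⟩ := exists_exchange (L \ P) hD (r - (a - 2 * b))
  have h1 : (P ∩ (L \ D)).card ≤ (D' ∩ (L \ D)).card + (P \ D').card := by
    refine (Finset.card_le_card fun x hx => ?_).trans (Finset.card_union_le _ _)
    simp only [Finset.mem_sdiff, Finset.mem_union, Finset.mem_inter] at hx ⊢
    tauto
  have h2 := card_inter_add_card_inter_sdiff D P L
  have h3 := card_inter_add_card_inter_sdiff P D L
  rw [Finset.union_comm] at h3
  have h4 := Finset.card_sdiff_add_card_inter L P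
  rw [Finset.inter_comm] at h4
  have h5 := Finset.le_card_sdiff (L \ P) L'
  have h6 := Finset.card_le_card (Finset.inter_subset_left : P ∩ L ⊆ P)
  have h7 := Finset.card_sdiff_add_card_inter (L \ P) S'
  rw [Finset.inter_comm (L \ P)] at h7
  obtain ⟨S, hS, hSb⟩ := Finset.exists_subset_card_eq (s := (L \ P) \ S') (n := b) (by omega)
  refine ⟨S, hS.trans (Finset.sdiff_subset.trans Finset.sdiff_subset), S', hS', hSb,
    hS'b.trans hDb, ?_, ?_, hS'D⟩
  · exact Finset.disjoint_left.2 fun x hx hy =>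
      (Finset.mem_sdiff.1 (Finset.mem_sdiff.1 (hS hy)).1).2 hx
  · exact Finset.disjoint_left.2 fun x hx hy => (Finset.mem_sdiff.1 (hS hx)).2 hy

/-- If `a ≥ 2 b`, then a path of even length can be colored so that the last color set is close
to a given target, without any separation of the lists. By induction: propagate the target two
vertices back, reach it up to some defect, and reduce the defect by `a - 2 b` in the last two
steps. -/
theorem exists_isPathColoring_near_target {L : ℕ → Finset α} {a b : ℕ} (hab : 2 * b ≤ a)
    {T : Finset α} (hT : T.card ≤ b) (j : ℕ) (hL : ∀ i ≤ 2 * j, (L i).card = a)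
    {D : Finset α} (hD : D ⊆ L (2 * j)) (hDb : D.card = b) :
    ∃ φ, φ 0 = T ∧ IsPathColoring L b (2 * j) φ ∧
      (φ (2 * j) \ D).card ≤ T.card - j * (a - 2 * b) := by
  induction j generalizing D with
  | zero =>
    refine ⟨fun _ => T, rfl, .zero _ _ _, ?_⟩
    simpa using Finset.card_le_card (Finset.sdiff_subset : T \ D ⊆ T)
  | succ j ih =>
    obtain ⟨D', hD', hD'b, hDD'⟩ := exists_backward_target (hL (2 * j + 1) (by omega))
      (hL (2 * j) (by omega)) hDb.le (by omega)
    obtain ⟨φ, h0, hφ, hcard⟩ := ih (fun i hi => hL i (by omega)) hD' hD'b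
    have hP : (φ (2 * j)).card ≤ b := by
      rcases Nat.eq_zero_or_pos j with rfl | hj
      · simpa [h0] using hT
      · exact (hφ.card _ (by omega) le_rfl).le
    obtain ⟨S, hS, S', hS', hSb, hS'b, d₁, d₂, hfin⟩ := exists_color_toward
      (hL (2 * j + 1) (by omega)) (hL (2 * j + 2) (by omega)) hab hP hD hDb hDD' hcard
    obtain ⟨ψ, hψ, hψS, hold⟩ := hφ.extend hS hSb d₁
    obtain ⟨χ, hχ, hχS, hold'⟩ := hψ.extend hS' hS'b (hψS ▸ d₂)
    refine ⟨χ, ((hold' 0 (by omega)).trans (hold 0 (by omega))).trans h0, hχ, ?_⟩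
    rw [show 2 * (j + 1) = 2 * j + 1 + 1 by ring, hχS, Nat.succ_mul]
    omega

theorem exists_isPathColoring_target {L : ℕ → Finset α} {a b : ℕ} (hab : 2 * b ≤ a)
    {T : Finset α} (hT : T.card ≤ b) {j : ℕ} (hj : 0 < j) (hTj : T.card ≤ j * (a - 2 * b))
    (hL : ∀ i ≤ 2 * j, (L i).card = a) {D : Finset α} (hD : D ⊆ L (2 * j)) (hDb : D.card = b) :
    ∃ φ, φ 0 = T ∧ IsPathColoring L b (2 * j) φ ∧ φ (2 * j) = D := by
  obtain ⟨φ, h0, hφ, hcard⟩ := exists_isPathColoring_near_target hab hT j hL hD hDb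
  refine ⟨φ, h0, hφ, Finset.eq_of_subset_of_card_le ?_ ?_⟩
  · rw [← Finset.sdiff_eq_empty_iff_subset, ← Finset.card_eq_zero]
    omega
  · rw [hDb, hφ.card _ (by omega) le_rfl]

/-- The colorings of the ends of a path with `k` inner vertices and `c`-separating lists of
size `a` always extend to the inner vertices. -/
def PathExtendable (α : Type*) [DecidableEq α] (a b c k : ℕ) : Prop :=
  ∀ L : ℕ → Finset α, (∀ i ≤ k + 1, (L i).card = a) →
    (∀ i ≤ k, (L i ∩ L (i + 1)).card ≤ c) →
    ∀ C₀ ⊆ L 0, ∀ C₁ ⊆ L (k + 1), C₀.card = b → C₁.card = b →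
      ∃ φ, φ 0 = C₀ ∧ φ (k + 1) = C₁ ∧ IsPathColoring L b (k + 1) φ

theorem card_inter_le_min {A B X : Finset α} {b c : ℕ} (hX : X ⊆ A) (hXb : X.card = b)
    (hAB : (A ∩ B).card ≤ c) : (X ∩ B).card ≤ min b c :=
  le_min (hXb ▸ Finset.card_le_card Finset.inter_subset_left)
    ((Finset.card_le_card (Finset.inter_subset_inter_right hX)).trans hAB)

theorem pathExtendable_greedy {a b c k : ℕ} (hc : c + b ≤ a) (hk : 0 < k)
    (h : 2 * min b c + (k - 1) * c ≤ k * (a - b)) : PathExtendable α a b c k := by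
  intro L hL hsep C₀ h₀ C₁ h₁ hb₀ hb₁
  obtain ⟨j, rfl⟩ : ∃ j, k = j + 1 := ⟨k - 1, by omega⟩
  obtain ⟨φ, hφ0, hφ, hcard⟩ := exists_isPathColoring_greedy (s := min b c) (min_le_right _ _)
    hc (card_inter_le_min h₀ hb₀ (hsep 0 (by omega))) j (fun i _ hi => hL i (by omega))
    (fun i _ hi => hsep i (by omega))
  have hmul : j * c ≤ j * (a - b) := Nat.mul_le_mul_left _ (by omega)
  have hLj := hL (j + 1) (by omega)
  have hlast : (L (j + 1) ∩ C₁).card ≤ min b c := by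
    rw [Finset.inter_comm]
    exact card_inter_le_min h₁ hb₁ (by rw [Finset.inter_comm]; exact hsep (j + 1) le_rfl)
  obtain ⟨S, hS, hSb, hd, hSM⟩ := exists_color_avoiding (b := b) hcard hlast (by omega)
  obtain ⟨ψ, hψ, hψS, hold⟩ := hφ.extend hS hSb hd
  rw [hLj] at hSM
  rw [Nat.add_sub_cancel, Nat.succ_mul j] at h
  have hdis : Disjoint (ψ (j + 1)) C₁ := by
    rw [hψS, Finset.disjoint_iff_inter_eq_empty, ← Finset.card_eq_zero]
    omega
  obtain ⟨χ, hχ, hχS, hold'⟩ := hψ.extend h₁ hb₁ hdis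
  exact ⟨χ, ((hold' 0 (by omega)).trans (hold 0 (by omega))).trans hφ0, hχS, hχ⟩

theorem pathExtendable_odd {a b c j : ℕ} (hab : 2 * b ≤ a) (h : b ≤ (j + 1) * (a - 2 * b)) :
    PathExtendable α a b c (2 * j + 1) := by
  intro L hL hsep C₀ h₀ C₁ h₁ hb₀ hb₁
  obtain ⟨φ, hφ0, hφ, hφ1⟩ := exists_isPathColoring_target hab hb₀.le (Nat.succ_pos j)
    (hb₀ ▸ h) (fun i hi => hL i (by omega)) h₁ hb₁
  exact ⟨φ, hφ0, hφ1, hφ⟩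

theorem pathExtendable_even {a b c j : ℕ} (hab : 2 * b ≤ a) (hj : 0 < j)
    (h : b ≤ j * (a - 2 * b)) : PathExtendable α a b c (2 * j) := by
  intro L hL hsep C₀ h₀ C₁ h₁ hb₀ hb₁
  have hk := hL (2 * j) (by omega)
  have := Finset.le_card_sdiff C₁ (L (2 * j))
  obtain ⟨D, hD, hDb⟩ := Finset.exists_subset_card_eq (s := L (2 * j) \ C₁) (n := b) (by omega)
  obtain ⟨φ, hφ0, hφ, hφ1⟩ := exists_isPathColoring_target hab hb₀.le hj
    (hb₀ ▸ h) (fun i hi => hL i (by omega)) (hD.trans Finset.sdiff_subset) hDb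
  obtain ⟨ψ, hψ, hψS, hold⟩ := hφ.extend h₁ hb₁
    (hφ1 ▸ Finset.disjoint_of_subset_left hD Finset.sdiff_disjoint)
  exact ⟨ψ, (hold 0 (by omega)).trans hφ0, hψS, hψ⟩

/-- For an even number of inner vertices the first one may also be colored greedily, which leaves a
path of even length and, if `c < a - b`, fewer than `b` blocked colors at its start. -/
theorem pathExtendable_even_of_lt {a b c j : ℕ} (hab : 2 * b ≤ a) (hj : 0 < j)
    (h : b + c - (a - b) ≤ j * (a - 2 * b)) :
    PathExtendable α a b c (2 * j) := by
  intro L hL hsep C₀ h₀ C₁ h₁ hb₀ hb₁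
  have hL1 := hL 1 (by omega)
  have hC : (C₀ ∩ L 1).card ≤ b := hb₀ ▸ Finset.card_le_card Finset.inter_subset_left
  obtain ⟨S, hS, hSb, hd, hSM⟩ := exists_color_avoiding (b := b) hC (hsep 1 (by omega))
    (by omega)
  have hT : (S ∩ L 2).card ≤ b := hSb ▸ Finset.card_le_card Finset.inter_subset_left
  obtain ⟨φ, hφ0, hφ, hφ1⟩ := exists_isPathColoring_target (L := fun i => L (i + 1)) hab hT hj
    (hSM.trans (by omega)) (fun i hi => hL (i + 1) (by omega)) h₁ hb₁
  refine ⟨fun i => if i = 0 then C₀ else if i = 1 then S else φ (i - 1), by simp, ?_, ?_, ?_, ?_⟩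
  · have : j ≠ 0 := by omega
    simpa [this] using hφ1
  · intro i h0 hi
    rcases (by omega : i = 1 ∨ 2 ≤ i) with rfl | h2
    · simpa using hS
    · have := hφ.subset (i - 1) (by omega) (by omega)
      simp only [Nat.sub_add_cancel h0] at this
      simpa [show i ≠ 0 by omega, show i ≠ 1 by omega] using this
  · intro i h0 hi
    rcases (by omega : i = 1 ∨ 2 ≤ i) with rfl | h2
    · simpa using hSb
    · simpa [show i ≠ 0 by omega, show i ≠ 1 by omega] using
        hφ.card (i - 1) (by omega) (by omega)
  · intro i hi
    rcases (by omega : i = 0 ∨ i = 1 ∨ 2 ≤ i) with rfl | rfl | h2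
    · simpa using hd
    · have h1 := hφ.disjoint 0 (by omega)
      have h2 := hφ.subset 1 (by omega) (by omega)
      rw [hφ0] at h1
      simp only [one_ne_zero, if_false, if_true, Nat.reduceAdd, OfNat.ofNat_ne_zero,
        OfNat.ofNat_ne_one, Nat.reduceSub]
      exact Finset.disjoint_left.2 fun x hx hy =>
        Finset.disjoint_left.1 h1 (Finset.mem_inter.2 ⟨hx, h2 hy⟩) hy
    · have := hφ.disjoint (i - 1) (by omega)
      rw [Nat.sub_add_cancel (by omega)] at this
      simpa [show i ≠ 0 by omega, show i ≠ 1 by omega] using this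

end PathColoring

/-! ### Necessary conditions from cycles -/

namespace SimpleGraph

theorem cycleGraph_adj_iff {n : ℕ} (hn : 2 ≤ n) (u v : Fin (n + 1)) :
    (cycleGraph (n + 1)).Adj u v ↔ u.val + 1 = v.val ∨ v.val + 1 = u.val ∨
      (u.val = n ∧ v.val = 0) ∨ (v.val = n ∧ u.val = 0) := by
  have hu := u.isLt
  have hv := v.isLt
  rw [cycleGraph_adj', Fin.sub_def, Fin.sub_def]
  simp only
  have key : ∀ x y : ℕ, x < n + 1 → y < n + 1 →
      ((n + 1 - y + x) % (n + 1) = 1 ↔ y + 1 = x ∨ (y = n ∧ x = 0)) := by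
    intro x y hx hy
    by_cases h : y ≤ x
    · rw [show n + 1 - y + x = x - y + (n + 1) by omega, Nat.add_mod_right,
        Nat.mod_eq_of_lt (by omega)]
      omega
    · rw [Nat.mod_eq_of_lt (by omega)]
      omega
  rw [key _ _ hu hv, key _ _ hv hu]
  tauto

/-- Free choosability of a cycle with vertices `0, …, n`. -/
theorem IsFreeChoosable.exists_cycle_coloring {n a b c : ℕ} (hn : 2 ≤ n)
    (h : (cycleGraph (n + 1)).IsFreeChoosable a b c) {L : ℕ → Finset ℤ}
    (hL : ∀ i ≤ n, (L i).card = a) (hsep : ∀ i < n, (L i ∩ L (i + 1)).card ≤ c)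
    (hsep' : (L n ∩ L 0).card ≤ c) {C : Finset ℤ} (hC : C ⊆ L 0) (hCb : C.card = b) :
    ∃ φ : ℕ → Finset ℤ, φ 0 = C ∧ (∀ i ≤ n, φ i ⊆ L i ∧ (φ i).card = b) ∧
      (∀ i < n, Disjoint (φ i) (φ (i + 1))) ∧ Disjoint (φ n) (φ 0) := by
  obtain ⟨φ, ⟨h1, h2⟩, h3⟩ := h (fun v => L v) (fun v => hL v (by omega)) (fun u v huv => by
    change (L u ∩ L v).card ≤ c
    rcases (cycleGraph_adj_iff hn u v).1 huv with h | h | ⟨h, h'⟩ | ⟨h, h'⟩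
    · rw [← h]; exact hsep _ (by omega)
    · rw [← h, Finset.inter_comm]; exact hsep _ (by omega)
    · rw [h, h']; exact hsep'
    · rw [h, h', Finset.inter_comm]; exact hsep') 0 C hC hCb
  have hφ : ∀ (i : ℕ) (hi : i < n + 1), φ (Fin.ofNat (n + 1) i) = φ ⟨i, hi⟩ := fun i hi => by
    congr 1; ext; simp [Nat.mod_eq_of_lt hi]
  refine ⟨fun i => φ (Fin.ofNat (n + 1) i), h3, fun i hi => ?_, fun i hi => ?_, ?_⟩
  · simp only [hφ i (by omega)]; exact h1 _
  · simp only [hφ i (by omega), hφ (i + 1) (by omega)]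
    exact h2 _ _ ((cycleGraph_adj_iff hn _ _).2 (Or.inl rfl))
  · simp only [hφ n (by omega), hφ 0 (by omega)]
    exact h2 _ _ ((cycleGraph_adj_iff hn _ _).2 (Or.inr (Or.inr (Or.inl ⟨rfl, rfl⟩))))

/-- A neighbour of the precolored vertex may lose `min b c` colors of its list. The lists here are
intervals of integers, disjoint except for those of the vertices `0` and `1`. -/
theorem IsFreeChoosable.min_add_le {n a b c : ℕ} (hn : 2 ≤ n) (hab : b ≤ a)
    (h : (cycleGraph (n + 1)).IsFreeChoosable a b c) : min b c + b ≤ a := by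
  obtain ⟨s, hs⟩ : ∃ s, s = min b c := ⟨_, rfl⟩
  let q : ℕ → ℤ := fun i => if i = 0 then 0 else if i = 1 then a - s else (i + 1) * a
  let L : ℕ → Finset ℤ := fun i => Finset.Ico (q i) (q i + a)
  have hq0 : q 0 = 0 := rfl
  have hq1 : q 1 = a - s := rfl
  have hq2 : ∀ i, 2 ≤ i → q i = (i + 1) * a := fun i hi => by
    simp [q, show i ≠ 0 by omega, show i ≠ 1 by omega]
  have hfar : ∀ i, 2 ≤ i → 2 * (a : ℤ) ≤ q i := fun i hi => by
    rw [hq2 i hi]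
    exact mul_le_mul_of_nonneg_right (by norm_cast; omega) (by positivity)
  have hdisj : ∀ i j, q i + a ≤ q j → L i ∩ L j = ∅ := fun i j hij => by
    ext x
    simp only [L, Finset.mem_inter, Finset.mem_Ico, Finset.notMem_empty, iff_false]
    omega
  obtain ⟨φ, h0, hφ, hd, -⟩ := h.exists_cycle_coloring hn (L := L)
    (fun i _ => by simp [L]) (fun i _ => by
      rcases (by omega : i = 0 ∨ i = 1 ∨ 2 ≤ i) with rfl | rfl | hi
      · have : L 0 ∩ L (0 + 1) ⊆ Finset.Ico (a - s : ℤ) a := fun x => by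
          simp only [L, Finset.mem_inter, Finset.mem_Ico, zero_add, hq0, hq1]
          omega
        refine (Finset.card_le_card this).trans ?_
        rw [Int.card_Ico]; omega
      · rw [hdisj 1 2 (by have := hfar 2 le_rfl; rw [hq1]; omega)]; simp
      · rw [hdisj _ _ (by rw [hq2 i hi, hq2 (i + 1) (by omega)]; push_cast; linarith)]; simp)
    (by rw [Finset.inter_comm, hdisj _ _ (by have := hfar n hn; rw [hq0]; omega)]; simp)
    (C := Finset.Ico (a - b : ℤ) a) (fun x => by
      simp only [L, Finset.mem_Ico, hq0]; omega) (by rw [Int.card_Ico]; omega)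
  have h1 := hφ 1 (by omega)
  have h01 := hd 0 (by omega)
  rw [h0] at h01
  have hsub : φ 1 ⊆ Finset.Ico (a : ℤ) (2 * a - s) := fun x hx => by
    have hxL := h1.1 hx
    have hxC := Finset.disjoint_right.1 h01 hx
    simp only [L, Finset.mem_Ico, hq1] at hxL hxC ⊢
    omega
  have := Finset.card_le_card hsub
  rw [h1.2, Int.card_Ico] at this
  omega

/-- The extremal list assignment of a cycle: apart from the colors shared with the precolored
vertex, each color lies in at most two lists, which belong to consecutive vertices `i` and
`i + 1`, and there are `e i` such colors. Then the color sets of the `k` other vertices are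
pairwise disjoint, and the number of available colors is `k * a - 2 * s - ∑ e i`. The lists are
intervals of integers. -/
theorem IsFreeChoosable.sum_le {k a b c s : ℕ} (hk : 3 ≤ k) (hab : b ≤ a) (hsb : s ≤ b)
    (hsc : s ≤ c) (e : ℕ → ℕ) (hec : ∀ i, e i ≤ c) (hea : ∀ i, e i + e (i + 1) ≤ a)
    (hes : ∀ i, s + e i ≤ a) (h : (cycleGraph (k + 1)).IsFreeChoosable a b c) :
    k * b + 2 * s + ∑ i ∈ Finset.range (k - 1), e i ≤ k * a := by
  obtain ⟨m, rfl⟩ : ∃ m, k = m + 2 := ⟨k - 2, by omega⟩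
  let q : ℕ → ℤ := fun i => -s + ∑ l ∈ Finset.range i, ((a : ℤ) - e l)
  have q0 : q 0 = -s := by simp [q]
  have qs : ∀ i, q (i + 1) = q i + (a - e i) := fun i => by
    simp only [q, Finset.sum_range_succ]; ring
  have qmono : Monotone q := monotone_nat_of_le_succ fun i => by
    have := hes i
    rw [qs]; omega
  have qpos : ∀ i, 1 ≤ i → 0 ≤ q i := fun i hi => by
    have h1 := hes 0
    have h2 := qmono hi
    have h3 := qs 0
    rw [zero_add] at h3
    omega
  have qfar : ∀ i j, i + 2 ≤ j → q i + a ≤ q j := fun i j hij => by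
    have h1 := hea i
    have h2 := qmono hij
    rw [qs, qs] at h2
    omega
  -- the list of the inner vertex `i + 1` of the cycle
  let I : ℕ → Finset ℤ := fun i =>
    if i = m + 1 then Finset.Ico (-s : ℤ) 0 ∪ Finset.Ico (q (m + 1)) (q (m + 1) + a - s)
    else Finset.Ico (q i) (q i + a)
  have I1 : ∀ i, i ≠ m + 1 → I i = Finset.Ico (q i) (q i + a) := fun i hi => if_neg hi
  have I2 : I (m + 1) = Finset.Ico (-s : ℤ) 0 ∪ Finset.Ico (q (m + 1)) (q (m + 1) + a - s) :=
    if_pos rfl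
  let L : ℕ → Finset ℤ := fun i => if i = 0 then Finset.Ico (-a : ℤ) 0 else I (i - 1)
  have L0 : L 0 = Finset.Ico (-a : ℤ) 0 := rfl
  have Ls : ∀ i, L (i + 1) = I i := fun i => by simp [L]
  have hcardI : ∀ i, (I i).card = a := fun i => by
    by_cases hi : i = m + 1
    · rw [hi, I2, Finset.card_union_of_disjoint, Int.card_Ico, Int.card_Ico]
      · have := hes 0; omega
      · have := qpos (m + 1) (by omega)
        exact Finset.disjoint_left.2 fun x hx hy => by
          simp only [Finset.mem_Ico] at hx hy; omega
    · rw [I1 i hi, Int.card_Ico]; omega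
  have hIm : m ≠ m + 1 := by omega
  have hlast := qpos (m + 1) (by omega)
  obtain ⟨φ, h0, hφ, hd, hd'⟩ := h.exists_cycle_coloring (by omega) (L := L)
    (fun i _ => by
      rcases i with _ | i
      · rw [L0, Int.card_Ico]; omega
      · rw [Ls, hcardI])
    (fun i hi => by
      rcases i with _ | i
      · have : L 0 ∩ L (0 + 1) ⊆ Finset.Ico (-s : ℤ) 0 := fun x => by
          rw [Ls, L0, I1 0 (by omega), q0]
          simp only [Finset.mem_inter, Finset.mem_Ico]
          omega
        refine (Finset.card_le_card this).trans ?_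
        rw [Int.card_Ico]; omega
      · have : L (i + 1) ∩ L (i + 1 + 1) ⊆ Finset.Ico (q (i + 1)) (q (i + 1) + e i) := fun x => by
          rw [Ls, Ls, I1 i (by omega)]
          have hqi := qs i
          by_cases hi' : i = m
          · have := qpos m (by omega)
            subst hi'
            rw [I2]
            simp only [Finset.mem_inter, Finset.mem_Ico, Finset.mem_union]
            omega
          · rw [I1 (i + 1) (by omega)]
            simp only [Finset.mem_inter, Finset.mem_Ico]
            omega
        refine (Finset.card_le_card this).trans ?_
        rw [Int.card_Ico]
        have := hec i
        omega)
    (by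
      have : L (m + 2) ∩ L 0 ⊆ Finset.Ico (-s : ℤ) 0 := fun x => by
        rw [Ls, L0, I2]
        simp only [Finset.mem_inter, Finset.mem_Ico, Finset.mem_union]
        omega
      refine (Finset.card_le_card this).trans ?_
      rw [Int.card_Ico]; omega)
    (C := Finset.Ico (-b : ℤ) 0) (fun x => by
      rw [L0]; simp only [Finset.mem_Ico]; omega) (by rw [Int.card_Ico]; omega)
  have hsubI : ∀ i ≤ m + 1, φ (i + 1) ⊆ I i := fun i hi => Ls i ▸ (hφ (i + 1) (by omega)).1
  have hnonneg : ∀ i ≤ m + 1, ∀ x ∈ φ (i + 1), 0 ≤ x := by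
    intro i hi x hx
    have hxI := hsubI i hi hx
    by_contra hneg
    have hqi := qpos i
    have hxC : x ∈ φ 0 := by
      rw [h0, Finset.mem_Ico]
      by_cases h1 : i = m + 1
      · rw [h1, I2] at hxI
        simp only [Finset.mem_Ico, Finset.mem_union] at hxI
        omega
      · rw [I1 i h1, Finset.mem_Ico] at hxI
        rcases Nat.eq_zero_or_pos i with rfl | h2
        · rw [q0] at hxI; omega
        · have := hqi h2; omega
    rcases Nat.eq_zero_or_pos i with rfl | h2
    · exact Finset.disjoint_left.1 (hd 0 (by omega)) hxC hx
    · by_cases h1 : i = m + 1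
      · subst h1; exact Finset.disjoint_left.1 hd' hx hxC
      · rw [I1 i h1, Finset.mem_Ico] at hxI
        have := hqi h2; omega
  have hlt : ∀ i ≤ m, ∀ x ∈ φ (i + 1), q i ≤ x ∧ x < q i + a := fun i hi x hx => by
    have := hsubI i (by omega) hx
    rwa [I1 i (by omega), Finset.mem_Ico] at this
  have hlt' : ∀ x ∈ φ (m + 1 + 1), q (m + 1) ≤ x ∧ x < q (m + 1) + a - s := fun x hx => by
    have h1 := hsubI (m + 1) le_rfl hx
    have h2 := hnonneg (m + 1) le_rfl x hx
    rw [I2] at h1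
    simp only [Finset.mem_Ico, Finset.mem_union] at h1
    omega
  have hdisj : ∀ i j, i < j → j ≤ m + 1 → Disjoint (φ (i + 1)) (φ (j + 1)) := by
    intro i j hij hj
    rcases (by omega : j = i + 1 ∨ i + 2 ≤ j) with rfl | h2
    · exact hd (i + 1) (by omega)
    · refine Finset.disjoint_left.2 fun x hx hy => ?_
      have h3 := hlt i (by omega) x hx
      have h4 := qfar i j h2
      rcases hj.eq_or_lt with rfl | h5
      · have := hlt' x hy; omega
      · have := hlt j (by omega) x hy; omega
  have hunion : (Finset.range (m + 2)).biUnion (fun i => φ (i + 1)) ⊆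
      Finset.Ico 0 (q (m + 1) + a - s) := by
    intro x hx
    obtain ⟨i, hi, hx⟩ := Finset.mem_biUnion.1 hx
    rw [Finset.mem_range] at hi
    refine Finset.mem_Ico.2 ⟨hnonneg i (by omega) x hx, ?_⟩
    by_cases h1 : i = m + 1
    · subst h1; exact (hlt' x hx).2
    · have h2 := (hlt i (by omega) x hx).2
      have h3 := qmono (show i ≤ m by omega)
      have h4 := qs m
      have h5 := hes m
      omega
  have hcount := Finset.card_le_card hunion
  rw [Finset.card_biUnion, Finset.sum_congr rfl (fun i hi =>
    (hφ (i + 1) (by have := Finset.mem_range.1 hi; omega)).2)] at hcount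
  · rw [Finset.sum_const, Finset.card_range, smul_eq_mul, Int.card_Ico, sub_zero] at hcount
    have hqm : q (m + 1) = -s + ((m + 1) * a - ∑ l ∈ Finset.range (m + 1), (e l : ℤ)) := by
      simp [q, Finset.sum_sub_distrib]
    have hs0 := hes 0
    have hc' : ((m + 2 : ℕ) : ℤ) * b ≤ q (m + 1) + a - s := by
      have : (((m + 2) * b : ℕ) : ℤ) ≤ ((q (m + 1) + a - s).toNat : ℤ) := by exact_mod_cast hcount
      rw [Int.toNat_of_nonneg (by omega)] at this
      push_cast at this ⊢
      exact this
    rw [hqm] at hc'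
    have : (((m + 2) * b + 2 * s + ∑ i ∈ Finset.range (m + 1), e i : ℕ) : ℤ) ≤
        (((m + 2) * a : ℕ) : ℤ) := by
      push_cast at hc' ⊢
      linarith
    exact_mod_cast this
  · intro i hi j hj hij
    simp only [Finset.coe_range, Set.mem_Iio] at hi hj
    rcases lt_or_gt_of_ne hij with h1 | h1
    · exact hdisj i j h1 (by omega)
    · exact (hdisj j i h1 (by omega)).symm

theorem sum_range_alternating (p p' n : ℕ) :
    ∑ i ∈ Finset.range n, (if Even i then p else p') = (n + 1) / 2 * p + n / 2 * p' := by
  induction n with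
  | zero => simp
  | succ n ih =>
    rw [Finset.sum_range_succ, ih]
    rcases Nat.even_or_odd' n with ⟨j, rfl | rfl⟩
    · rw [if_pos (by simp), show (2 * j + 1 + 1) / 2 = j + 1 by omega,
        show (2 * j + 1) / 2 = j by omega, show 2 * j / 2 = j by omega]
      ring
    · rw [if_neg (by simp [parity_simps]), show (2 * j + 1 + 1 + 1) / 2 = j + 1 by omega,
        show (2 * j + 1 + 1) / 2 = j + 1 by omega, show (2 * j + 1) / 2 = j by omega]
      ring

/-- `IsFreeChoosable.sum_le` for overlaps that alternate between `p` and `p'`. -/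
theorem IsFreeChoosable.alternating_le {k a b c s : ℕ} (hk : 3 ≤ k) (hab : b ≤ a) (hsb : s ≤ b)
    (hsc : s ≤ c) {p p' : ℕ} (hp : p ≤ c) (hp' : p' ≤ c) (hpp : p + p' ≤ a) (hps : s + p ≤ a)
    (hps' : s + p' ≤ a) (h : (cycleGraph (k + 1)).IsFreeChoosable a b c) :
    2 * s + k / 2 * p + (k - 1) / 2 * p' ≤ k * (a - b) := by
  have := h.sum_le hk hab hsb hsc (fun i => if Even i then p else p')
    (fun i => by split_ifs <;> assumption)
    (fun i => by
      by_cases hi : Even i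
      · simp [hi, parity_simps]; omega
      · simp [hi, parity_simps]; omega)
    (fun i => by split_ifs <;> assumption)
  rw [sum_range_alternating, Nat.sub_add_cancel (by omega)] at this
  rw [Nat.mul_sub]
  omega

/-- If the cycle with `k + 1` vertices is free-choosable, then every coloring of the ends of a
path with `k` inner vertices extends, even if the two ends have different color sets. The cycle
bounds the parameters through its extremal list assignments, and in each range of the parameters
this bound is what one of the coloring procedures for paths needs. -/
theorem IsFreeChoosable.pathExtendable {k a b c : ℕ} (hk : 3 ≤ k) (hab : b ≤ a)
    (h : (cycleGraph (k + 1)).IsFreeChoosable a b c) : PathExtendable ℤ a b c k := by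
  have hmin := h.min_add_le (by omega) hab
  have hkk : k / 2 + (k - 1) / 2 = k - 1 := by omega
  have const : c + min b c ≤ a → 2 * c ≤ a → c + b ≤ a → PathExtendable ℤ a b c k := by
    intro h1 h2 h3
    have := h.alternating_le hk hab (min_le_left b c) (min_le_right b c) (p := c) (p' := c)
      le_rfl le_rfl (by omega) (by omega) (by omega)
    rw [add_assoc, ← add_mul, hkk] at this
    exact pathExtendable_greedy h3 (by omega) this
  by_cases h2b : a < 2 * b
  · exact const (by omega) (by omega) (by omega)
  by_cases h2c : 2 * c ≤ a
  · exact const (by omega) h2c (by omega)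
  rw [not_lt] at h2b
  rw [not_le] at h2c
  obtain ⟨e, rfl⟩ : ∃ e, a = 2 * b + e := ⟨a - 2 * b, by omega⟩
  rcases Nat.even_or_odd' k with ⟨j, rfl | rfl⟩
  · by_cases hc : c + b ≤ 2 * b + e
    · have := h.alternating_le hk hab le_rfl (by omega) (p := c) (p' := 2 * b + e - c)
        le_rfl (by omega) (by omega) (by omega) (by omega)
      refine pathExtendable_even_of_lt h2b (by omega) ?_
      rw [show 2 * j / 2 = j by omega, show (2 * j - 1) / 2 = j - 1 by omega] at this
      obtain ⟨i, rfl⟩ : ∃ i, j = i + 1 := ⟨j - 1, by omega⟩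
      rw [show 2 * b + e - b = b + e by omega] at this ⊢
      rw [show 2 * b + e - 2 * b = e by omega]
      obtain ⟨f, hf⟩ : ∃ f, 2 * b + e = c + f := ⟨2 * b + e - c, by omega⟩
      rw [hf, show c + f - c = f by omega, Nat.add_sub_cancel] at this
      have hf' : i * (c + f) = i * (2 * b + e) := by rw [hf]
      have : b + c ≤ (i + 1) * e + (b + e) := by nlinarith
      omega
    · have := h.alternating_le hk hab le_rfl (by omega) (p := b + e) (p' := b)
        (by omega) (by omega) (by omega) (by omega) (by omega)
      refine pathExtendable_even h2b (by omega) ?_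
      rw [show 2 * j / 2 = j by omega, show (2 * j - 1) / 2 = j - 1 by omega] at this
      obtain ⟨i, rfl⟩ : ∃ i, j = i + 1 := ⟨j - 1, by omega⟩
      rw [show 2 * b + e - b = b + e by omega, Nat.add_sub_cancel] at this
      rw [show 2 * b + e - 2 * b = e by omega]
      nlinarith
  · have := h.alternating_le hk hab le_rfl (by omega) (p := (2 * b + e) / 2)
      (p' := 2 * b + e - (2 * b + e) / 2)
      (by omega) (by omega) (by omega) (by omega) (by omega)
    refine pathExtendable_odd h2b ?_
    rw [show (2 * j + 1) / 2 = j by omega, show (2 * j + 1 - 1) / 2 = j by omega, add_assoc,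
      ← mul_add, show (2 * b + e) / 2 + (2 * b + e - (2 * b + e) / 2) = 2 * b + e by omega,
      show 2 * b + e - b = b + e by omega] at this
    rw [show 2 * b + e - 2 * b = e by omega]
    nlinarith

end SimpleGraph

/-! ### From cycles to outerplanar graphs and back -/

namespace SimpleGraph

variable {V : Type*} {G : SimpleGraph V}

/-- The extension of a coloring of `v` to the vertices of a set `T`, by induction on `T`: remove
a leaf or the inner vertices of an ear, color the rest, and color what was removed. -/
theorem ThetaFree.exists_coloring_on (hG : G.ThetaFree) {g : ℕ} (hg : g ≤ G.egirth)
    (hg5 : 5 ≤ g) {a b c : ℕ} (hmin : min b c + b ≤ a) (hext : PathExtendable ℤ a b c (g - 2))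
    {L : V → Finset ℤ} (hL : IsListAssignment L a) (hsep : G.IsSeparating c L) {v : V}
    {C : Finset ℤ} (hC : C ⊆ L v) (hCb : C.card = b) (T : Finset V) (hv : v ∉ T) :
    ∃ φ : V → Finset ℤ, φ v = C ∧ (∀ x, x = v ∨ x ∈ T → φ x ⊆ L x ∧ (φ x).card = b) ∧
      ∀ x y, (x = v ∨ x ∈ T) → (y = v ∨ y ∈ T) → G.Adj x y → Disjoint (φ x) (φ y) := by
  classical
  induction T using Finset.strongInduction with
  | H T ih =>
  rcases T.eq_empty_or_nonempty with rfl | hT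
  · refine ⟨fun _ => C, rfl, ?_, ?_⟩
    · rintro x (rfl | hx)
      · exact ⟨hC, hCb⟩
      · simp at hx
    · rintro x y (rfl | hx) (rfl | hy) hxy
      · exact absurd rfl hxy.ne
      all_goals simp_all
  let H : SimpleGraph V :=
    { Adj := fun x y => G.Adj x y ∧ (x = v ∨ x ∈ T) ∧ (y = v ∨ y ∈ T)
      symm := ⟨fun _ _ h => ⟨h.1.symm, h.2.2, h.2.1⟩⟩
      loopless := ⟨fun _ h => G.loopless.irrefl _ h.1⟩ }
  have hHG : H ≤ G := fun _ _ h => h.1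
  have hcl : H.IsClique (H.vertexBoundary T) := by
    rintro x ⟨hx, s, -, hs⟩ y ⟨hy, t, -, ht⟩ hxy
    exact absurd ((hs.2.2.resolve_right hx).trans (ht.2.2.resolve_right hy).symm) hxy
  rcases (hG.mono hHG).exists_leaf_or_ear (hg.trans (egirth_anti hHG)) hg5 T hT hcl with
    ⟨x, hxT, hx⟩ | ⟨f, hf⟩
  · -- `x` is a leaf
    obtain ⟨φ, hφv, hφ, hd⟩ := ih (T.erase x) (Finset.erase_ssubset hxT)
      (fun h => hv (Finset.mem_of_mem_erase h))
    have hxv : x ≠ v := fun h => hv (h ▸ hxT)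
    have hold : ∀ y, y ≠ x → (y = v ∨ y ∈ T) → (y = v ∨ y ∈ T.erase x) := fun y hyx hy =>
      hy.imp_right fun h => Finset.mem_erase.2 ⟨hyx, h⟩
    obtain ⟨P, hP, hPL⟩ : ∃ P : Finset ℤ, (∀ y, H.Adj x y → φ y = P) ∧
        (P ∩ L x).card ≤ min b c := by
      by_cases h : ∃ y, H.Adj x y
      · obtain ⟨y, hy⟩ := h
        refine ⟨φ y, fun z hz => by rw [hx y z hy hz], ?_⟩
        have hφy := hφ y (hold y hy.ne' hy.2.2)
        exact card_inter_le_min hφy.1 hφy.2 (hsep y x hy.1.symm)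
      · exact ⟨∅, fun y hy => absurd ⟨y, hy⟩ h, by simp⟩
    obtain ⟨S, hS, hSb, hPS, -⟩ := exists_color_avoiding (M := ∅) (b := b) hPL le_rfl
      (by rw [hL x]; exact hmin)
    have key : ∀ y, H.Adj x y →
        Disjoint (Function.update φ x S x) (Function.update φ x S y) := fun y hy => by
      rw [Function.update_self, Function.update_of_ne hy.ne', hP y hy]
      exact hPS.symm
    refine ⟨Function.update φ x S, by rw [Function.update_of_ne hxv.symm, hφv], ?_, ?_⟩
    · intro y hy
      by_cases hyx : y = x
      · subst hyx; rw [Function.update_self]; exact ⟨hS, hSb⟩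
      · rw [Function.update_of_ne hyx]; exact hφ y (hold y hyx hy)
    · intro y z hy hz hyz
      by_cases hyx : y = x
      · subst hyx; exact key z ⟨hyz, hy, hz⟩
      by_cases hzx : z = x
      · subst hzx; exact (key y ⟨hyz.symm, hz, hy⟩).symm
      rw [Function.update_of_ne hyx, Function.update_of_ne hzx]
      exact hd y z (hold y hyx hy) (hold z hzx hz) hyz
  · -- `f` is an ear
    let R : V → Prop := fun x => ∃ i, 0 < i ∧ i < g - 1 ∧ x = f i
    obtain ⟨φ, hφv, hφ, hd⟩ := ih (T.filter (¬ R ·))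
      (Finset.filter_ssubset.2 ⟨f 1, hf.mem 1 (by omega) (by omega),
        fun h => h ⟨1, by omega, by omega, rfl⟩⟩)
      (fun h => hv (Finset.mem_of_mem_filter v h))
    have hold : ∀ y, ¬ R y → (y = v ∨ y ∈ T) → (y = v ∨ y ∈ T.filter (¬ R ·)) := fun y hyR hy =>
      hy.imp_right fun h => Finset.mem_filter.2 ⟨h, hyR⟩
    have hvR : ¬ R v := by
      rintro ⟨i, h1, h2, h3⟩
      exact hv (h3 ▸ hf.mem i h1 h2)
    have h0R : ¬ R (f 0) := by
      rintro ⟨i, h1, h2, h3⟩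
      have := hf.inj 0 i (by omega) (by omega) h3
      omega
    have hnR : ¬ R (f (g - 1)) := by
      rintro ⟨i, h1, h2, h3⟩
      have := hf.inj (g - 1) i (by omega) (by omega) h3
      omega
    have hφ0 := hφ _ (hold _ h0R (hf.adj 0 (by omega)).2.1)
    have hφn := hφ _ (hold _ hnR (by
      have := (hf.adj (g - 2) (by omega)).2.2
      rwa [show g - 2 + 1 = g - 1 by omega] at this))
    have hg2 : g - 2 + 1 = g - 1 := by omega
    obtain ⟨χ, hχ0, hχn, hχ⟩ := hext (fun i => L (f i)) (fun i _ => hL _)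
      (fun i hi => hsep _ _ (hf.adj i (by omega)).1) (φ (f 0)) hφ0.1 (φ (f (g - 1)))
      (by rw [hg2]; exact hφn.1) hφ0.2 hφn.2
    rw [hg2] at hχn hχ
    let ψ : V → Finset ℤ := fun x => if h : R x then χ h.choose else φ x
    have hψR : ∀ x, ¬ R x → ψ x = φ x := fun x hx => dif_neg hx
    have hψf : ∀ i ≤ g - 1, ψ (f i) = χ i := by
      intro i hi
      rcases (by omega : i = 0 ∨ i = g - 1 ∨ (0 < i ∧ i < g - 1)) with rfl | rfl | ⟨h1, h2⟩
      · rw [hψR _ h0R, hχ0]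
      · rw [hψR _ hnR, hχn]
      · have hR : R (f i) := ⟨i, h1, h2, rfl⟩
        obtain ⟨h3, h4, h5⟩ := hR.choose_spec
        have : ψ (f i) = χ hR.choose := dif_pos hR
        rw [this, ← hf.inj i _ hi (by omega) h5]
    have key : ∀ x y, R x → H.Adj x y → Disjoint (ψ x) (ψ y) := by
      rintro x y ⟨i, h1, h2, rfl⟩ hxy
      rcases hf.eq_of_adj i h1 h2 y hxy with rfl | rfl
      · have := hχ.disjoint (i - 1) (by omega)
        rw [Nat.sub_add_cancel h1] at this
        rw [hψf i (by omega), hψf (i - 1) (by omega)]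
        exact this.symm
      · rw [hψf i (by omega), hψf (i + 1) (by omega)]
        exact hχ.disjoint i h2
    refine ⟨ψ, by rw [hψR v hvR, hφv], fun x hx => ?_, fun x y hx hy hxy => ?_⟩
    · by_cases hxR : R x
      · obtain ⟨i, h1, h2, rfl⟩ := hxR
        rw [hψf i (by omega)]
        exact ⟨hχ.subset i h1 (by omega), hχ.card i h1 (by omega)⟩
      · rw [hψR x hxR]; exact hφ x (hold x hxR hx)
    · by_cases hxR : R x
      · exact key x y hxR ⟨hxy, hx, hy⟩
      by_cases hyR : R y
      · exact (key y x hyR ⟨hxy.symm, hy, hx⟩).symm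
      rw [hψR x hxR, hψR y hyR]
      exact hd x y (hold x hxR hx) (hold y hyR hy) hxy

theorem ThetaFree.isFreeChoosable [Finite V] (hG : G.ThetaFree) {g : ℕ} (hg : g ≤ G.egirth)
    (hg5 : 5 ≤ g) {a b c : ℕ} (hab : b ≤ a)
    (h : (cycleGraph (g - 1)).IsFreeChoosable a b c) : G.IsFreeChoosable a b c := by
  classical
  have := Fintype.ofFinite V
  rw [show g - 1 = g - 2 + 1 by omega] at h
  intro L hL hsep v C hC hCb
  obtain ⟨φ, hφv, hφ, hd⟩ := hG.exists_coloring_on hg hg5 (h.min_add_le (by omega) hab)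
    (h.pathExtendable (by omega) hab) hL hsep hC hCb (Finset.univ.erase v)
    (Finset.notMem_erase v _)
  have hall : ∀ x, x = v ∨ x ∈ Finset.univ.erase v := fun x => by
    simpa using em (x = v)
  exact ⟨φ, ⟨fun x => hφ x (hall x), fun x y => hd x y (hall x) (hall y)⟩, hφv⟩

/-- A shortest cycle has no chord. -/
theorem exists_embedding_cycleGraph {n : ℕ} (hn : 2 ≤ n) (hg : G.egirth = (n + 1 : ℕ)) :
    ∃ f : Fin (n + 1) → V, Function.Injective f ∧
      ∀ i j, G.Adj (f i) (f j) ↔ (cycleGraph (n + 1)).Adj i j := by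
  obtain ⟨v, w, hw, hlen⟩ := (exists_egirth_eq_length (G := G)).2 (fun h => by
    rw [egirth_eq_top.2 h] at hg; exact ENat.top_ne_natCast _ hg)
  have hl : w.length = n + 1 := by
    rw [hg] at hlen; exact_mod_cast hlen.symm
  have hchord : ∀ i j, i < j → j ≤ n → G.Adj (w.getVert i) (w.getVert j) →
      j = i + 1 ∨ (i = 0 ∧ j = n) := by
    intro i j hij hj hadj
    by_contra hcon
    have hp := (hw.isPath_take (n := j) (by omega)).drop i
    have hlen' : ((w.take j).drop i).length = j - i := by
      rw [Walk.drop_length, Walk.take_length]; omega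
    have := le_length_add_one_of_isPath hp (by omega)
      (by rw [Walk.take_getVert, min_eq_right hij.le]; exact hadj.symm) hg.ge
    omega
  have hsucc : ∀ i, i ≤ n → G.Adj (w.getVert i) (w.getVert (i + 1)) := fun i hi =>
    w.adj_getVert_succ (by omega)
  have hclose : G.Adj (w.getVert n) (w.getVert 0) := by
    have := hsucc n le_rfl
    rw [← hl, w.getVert_length] at this
    rwa [w.getVert_zero]
  refine ⟨fun i => w.getVert i, fun i j hij => Fin.ext ?_, fun i j => ?_⟩
  · refine hw.getVert_injOn' ?_ ?_ hij
    · have := i.isLt; simp only [Set.mem_ofPred_eq]; omega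
    · have := j.isLt; simp only [Set.mem_ofPred_eq]; omega
  · have hi := i.isLt
    have hj := j.isLt
    rw [cycleGraph_adj_iff hn]
    constructor
    · intro h
      rcases lt_trichotomy i.val j.val with h1 | h1 | h1
      · have := hchord _ _ h1 (by omega) h; omega
      · exact absurd (congrArg w.getVert h1) h.ne
      · have := hchord _ _ h1 (by omega) h.symm; omega
    · change _ → G.Adj (w.getVert i) (w.getVert j)
      rintro (h | h | ⟨h, h'⟩ | ⟨h, h'⟩)
      · rw [← h]; exact hsucc _ (by omega)
      · rw [← h]; exact (hsucc _ (by omega)).symm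
      · rw [h, h']; exact hclose
      · rw [h, h']; exact hclose.symm

/-- Free choosability passes to induced subgraphs: give the other vertices lists of new
colors. -/
theorem IsFreeChoosable.of_embedding [Finite V] {W : Type*} [Finite W] {H : SimpleGraph W}
    {f : W → V} (hf : Function.Injective f) (hadj : ∀ i j, G.Adj (f i) (f j) ↔ H.Adj i j)
    {a b c : ℕ} (h : G.IsFreeChoosable a b c) : H.IsFreeChoosable a b c := by
  classical
  intro L hL hsep v C hC hCb
  have := Fintype.ofFinite W
  obtain ⟨idx, hidx⟩ := Countable.exists_injective_nat V
  obtain ⟨M, hM⟩ := (Finset.univ.biUnion L).bddAbove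
  have hM' : ∀ i, ∀ x ∈ L i, x ≤ M := fun i x hx =>
    hM (Finset.mem_coe.2 (Finset.mem_biUnion.2 ⟨i, Finset.mem_univ i, hx⟩))
  let N : V → Finset ℤ := fun x => Finset.Ioc (M + idx x * a) (M + (idx x + 1) * a)
  have hNM : ∀ x, ∀ z ∈ N x, M < z := fun x z hz => by
    have h1 := (Finset.mem_Ioc.1 hz).1
    have h2 : (0 : ℤ) ≤ idx x * a := by positivity
    omega
  have hN : ∀ x y, x ≠ y → N x ∩ N y = ∅ := by
    have key : ∀ x y, idx x < idx y → Disjoint (N x) (N y) := fun x y hxy =>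
      Finset.disjoint_left.2 fun z hx hy => by
        have h1 := (Finset.mem_Ioc.1 hx).2
        have h2 := (Finset.mem_Ioc.1 hy).1
        have h3 : ((idx x : ℤ) + 1) * a ≤ idx y * a :=
          mul_le_mul_of_nonneg_right (by exact_mod_cast hxy) (by positivity)
        omega
    intro x y hxy
    rw [← Finset.disjoint_iff_inter_eq_empty]
    rcases lt_or_gt_of_ne (hidx.ne hxy) with h1 | h1
    · exact key x y h1
    · exact (key y x h1).symm
  have hLN : ∀ i x, L i ∩ N x = ∅ := fun i x => Finset.disjoint_iff_inter_eq_empty.1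
    (Finset.disjoint_left.2 fun z h1 h2 => absurd (hM' i z h1) (not_le.2 (hNM x z h2)))
  have hE : ∀ i, Function.extend f L N (f i) = L i := fun i => hf.extend_apply L N i
  have hE' : ∀ x, (∀ i, f i ≠ x) → Function.extend f L N x = N x := fun x hx =>
    Function.extend_apply' _ _ _ (fun ⟨i, hi⟩ => hx i hi)
  obtain ⟨φ, ⟨h1, h2⟩, h3⟩ := h (Function.extend f L N) (fun x => by
    by_cases hx : ∃ i, f i = x
    · obtain ⟨i, rfl⟩ := hx
      rw [hE, hL i]
    · push Not at hx
      rw [hE' x hx, Int.card_Ioc, show M + (idx x + 1) * a - (M + idx x * a) = (a : ℤ) by ring,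
        Int.toNat_natCast]) (fun x y hxy => by
    by_cases hx : ∃ i, f i = x
    · obtain ⟨i, rfl⟩ := hx
      by_cases hy : ∃ j, f j = y
      · obtain ⟨j, rfl⟩ := hy
        rw [hE, hE]; exact hsep i j ((hadj i j).1 hxy)
      · push Not at hy
        rw [hE, hE' y hy, hLN]; simp
    · push Not at hx
      by_cases hy : ∃ j, f j = y
      · obtain ⟨j, rfl⟩ := hy
        rw [hE, hE' x hx, Finset.inter_comm, hLN]; simp
      · push Not at hy
        rw [hE' x hx, hE' y hy, hN x y hxy.ne]; simp) (f v) C (by rw [hE]; exact hC) hCb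
  refine ⟨fun i => φ (f i), ⟨fun i => ?_, fun i j hij => h2 _ _ ((hadj i j).2 hij)⟩, h3⟩
  have := h1 (f i)
  rwa [hE] at this

theorem fsep_le_fsep {V W : Type*} {G : SimpleGraph V} {H : SimpleGraph W} {a b : ℕ}
    (hab : b ≤ a) (h : ∀ c, G.IsFreeChoosable a b c → H.IsFreeChoosable a b c) :
    G.fsep a b ≤ H.fsep a b :=
  (H.isGreatest_fsep hab).2 ⟨(G.isGreatest_fsep hab).1.1, h _ (G.isGreatest_fsep hab).1.2⟩

end SimpleGraph

theorem mainTheorem5 {V : Type*} [Finite V] (G : SimpleGraph V) (hG : G.IsOuterplanar)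
    (g : ℕ) (hg : G.egirth = (g : ℕ∞)) (hg5 : 5 ≤ g) (a b : ℕ) (hb : 1 ≤ b) (hab : b ≤ a) :
    (SimpleGraph.cycleGraph (g - 1)).fsep a b ≤ G.fsep a b ∧
      G.fsep a b ≤ (SimpleGraph.cycleGraph g).fsep a b := by
  refine ⟨SimpleGraph.fsep_le_fsep hab fun c h =>
    hG.thetaFree.isFreeChoosable hg.ge hg5 hab h, SimpleGraph.fsep_le_fsep hab fun c h => ?_⟩
  obtain ⟨n, rfl⟩ : ∃ n, g = n + 1 := ⟨g - 1, by omega⟩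
  obtain ⟨f, hf, hadj⟩ := SimpleGraph.exists_embedding_cycleGraph (by omega) hg
  exact h.of_embedding hf hadj
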